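/- Let $X(t)$, $t\ge 0$, be a continuous-time Markov chain with right-continuous paths on a finite set $\mathcal S$, with irreducible generator $Q$, arbitrary initial law, and transition matrix $P(t)=e^{Qt}$. A monitor queries the chain. Query $k=0,1,2,\dots$ takes a time $Y_k\ge 0$ to reach the source, which replies with its current state; the reply takes a time $D_k\ge 0$ to reach the monitor. All delays are mutually independent and independent of the process $X$; the $Y_k$ have a common law $F^Y$ and the $D_k$ a common law $F^D$, both with finite mean. Let $Y\sim F^Y$ and $D\sim F^D$ be independent and put $Z=Y+D$. The first query is sent at a fixed time $t_0\ge 0$. When reply $k$ arrives, reporting state $i$ with age $d=D_k$, the monitor waits $W(i,d)\ge 0$ time units and then sends query $k+1$, where $W$ is a bounded function, measurable in $d$ (a stationary waiting policy). Assume that $\mathbb E[W(i,D)]+\mathbb E[Z]>0$ for every $i\in\mathcal S$. The monitor uses an estimator $\hat x(i,a)\in\mathcal S$, measurable in $a\ge 0$: its estimate $\hat X(t)$ at time $t$ is $\hat x(i,a)$ if the most recently received reply reported state $i$, sampled $a$ time units before $t$; before the first reply arrives, $\hat X(t)$ is an arbitrary deterministic measurable function of $t$. Define the mean binary freshness by $$\mathbb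 E[\Delta]=\limsup_{T\to\infty}\frac1T\,\mathbb E\left[\int_0^T \mathbf 1\{X(t)=\hat X(t)\}\,dt\right],$$ and let $$\tilde P_{i,j}=\int\!\!\int P_{i,j}\bigl(d+W(i,d)+y\bigr)\,dF^Y(y)\,dF^D(d).$$ Then the equations $\sum_{i}\phi_i\tilde P_{i,j}=\phi_j$ $(j\in\mathcal S)$ and $\sum_i\phi_i=1$ have a unique real solution $\phi$; this $\phi$ is a probability mass function on $\mathcal S$; and $$\mathbb E[\Delta]=\frac{\mathbb E\left[\displaystyle\int_{D'}^{D'+W(X,D')+Z}P_{X,\hat x(X,t)}(t)\,dt\right]}{\mathbb E[W(X,D')]+\mathbb E[Z]},$$ where on the right-hand side $X$ denotes a random state with probability mass function $\phi$, $D'$ is an independent copy of $D$, and $X$, $D'$, $Y$, $D$ are independent. -/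

import Mathlib

open MeasureTheory ProbabilityTheory Filter Topology
open scoped NNReal

namespace QuerySampling

noncomputable section

variable {S : Type*} [Fintype S] [DecidableEq S] [MeasurableSpace S]
variable {Ω : Type*} [MeasurableSpace Ω]

/-- `Q` is the generator (rate matrix) of a finite-state continuous-time Markov chain. -/
structure IsGenerator (Q : Matrix S S ℝ) : Prop where
  nonneg_of_ne : ∀ i j, i ≠ j → 0 ≤ Q i j
  row_sum : ∀ i, ∑ j, Q i j = 0

/-- Irreducibility: every state can be reached from every state along transitions of
positive rate. -/
def IsIrreducible (Q : Matrix S S ℝ) : Prop :=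
  ∀ i j, Relation.ReflTransGen (fun a b => 0 < Q a b) i j

/-- The transition matrix `P(t) = exp (t Q)`. -/
def transitionMatrix (Q : Matrix S S ℝ) (t : ℝ) : Matrix S S ℝ :=
  NormedSpace.exp (t • Q)

/-- `X` is a continuous-time Markov chain with generator `Q` and an arbitrary initial law:
its paths are right-continuous (for the discrete topology on the states) and it satisfies the
Markov property with transition matrices `exp (t Q)`. -/
structure IsCTMC (Q : Matrix S S ℝ) (X : ℝ≥0 → Ω → S) (μ : Measure Ω) : Prop where
  measurable : ∀ t, Measurable (X t)
  right_continuous : ∀ ω t, ∀ᶠ s in 𝓝[>] t, X s ω = X t ω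
  markov : ∀ (n : ℕ) (t : ℕ → ℝ≥0), Monotone t → ∀ x : ℕ → S,
    μ.real {ω | ∀ k ≤ n + 1, X (t k) ω = x k} =
      μ.real {ω | ∀ k ≤ n, X (t k) ω = x k} *
        transitionMatrix Q ((t (n + 1) : ℝ) - (t n : ℝ)) (x n) (x (n + 1))

/-- The forward delays `Y k` have law `FY`, the backward delays `D k` have law `FD`, both laws
have finite mean, all the delays are mutually independent, and the sequence of all delays is
independent of the process `X`. -/
structure IsDelaySequence (X : ℝ≥0 → Ω → S) (Y D : ℕ → Ω → ℝ≥0) (FY FD : Measure ℝ≥0)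
    (μ : Measure Ω) : Prop where
  measurable_forward : ∀ k, Measurable (Y k)
  measurable_backward : ∀ k, Measurable (D k)
  law_forward : ∀ k, μ.map (Y k) = FY
  law_backward : ∀ k, μ.map (D k) = FD
  integrable_forward : Integrable (fun y : ℝ≥0 => (y : ℝ)) FY
  integrable_backward : Integrable (fun d : ℝ≥0 => (d : ℝ)) FD
  indep_delays : iIndepFun (fun (m : ℕ ⊕ ℕ) (ω : Ω) => Sum.elim Y D m ω) μ
  indep_process :
    IndepFun (fun ω (t : ℝ≥0) => X t ω) (fun ω (m : ℕ ⊕ ℕ) => Sum.elim Y D m ω) μ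

/-- The time at which query number `k` reaches the source, which is when the state reported by
reply number `k` is sampled. The first query is sent at time `t₀`; reply number `k` arrives
`D k` time units after its sampling time, the monitor then waits `W i d`, where `i` is the
reported state and `d = D k` is its age, and sends query number `k + 1`, which
takes `Y (k + 1)` time units to reach the source. -/
def sampleTime (X : ℝ≥0 → Ω → S) (Y D : ℕ → Ω → ℝ≥0) (W : S → ℝ≥0 → ℝ≥0) (t₀ : ℝ≥0) :
    ℕ → Ω → ℝ≥0
  | 0, ω => t₀ + Y 0 ω
  | k + 1, ω =>
      sampleTime X Y D W t₀ k ω + D k ω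
        + W (X (sampleTime X Y D W t₀ k ω) ω) (D k ω) + Y (k + 1) ω

/-- The time at which the monitor receives reply number `k`. -/
def replyTime (X : ℝ≥0 → Ω → S) (Y D : ℕ → Ω → ℝ≥0) (W : S → ℝ≥0 → ℝ≥0) (t₀ : ℝ≥0)
    (k : ℕ) (ω : Ω) : ℝ≥0 :=
  sampleTime X Y D W t₀ k ω + D k ω

/-- The index of the most recent reply received by time `t` (meaningful once a reply has been
received). -/
def lastReply (X : ℝ≥0 → Ω → S) (Y D : ℕ → Ω → ℝ≥0) (W : S → ℝ≥0 → ℝ≥0) (t₀ : ℝ≥0)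
    (t : ℝ≥0) (ω : Ω) : ℕ :=
  sSup {k : ℕ | replyTime X Y D W t₀ k ω ≤ t}

/-- The estimate of the monitor at time `t`: `e₀ t` as long as no reply has been received, and
`e i a` if the most recent reply reported the state `i` and that sample is now `a` time units
old. -/
def estimate (X : ℝ≥0 → Ω → S) (Y D : ℕ → Ω → ℝ≥0) (W : S → ℝ≥0 → ℝ≥0) (t₀ : ℝ≥0)
    (e₀ : ℝ≥0 → S) (e : S → ℝ≥0 → S) (t : ℝ≥0) (ω : Ω) : S :=
  if t < replyTime X Y D W t₀ 0 ω then e₀ t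
  else
    e (X (sampleTime X Y D W t₀ (lastReply X Y D W t₀ t ω) ω) ω)
      (t - sampleTime X Y D W t₀ (lastReply X Y D W t₀ t ω) ω)

/-- The mean binary freshness
`limsup_{T → ∞} (1 / T) E[∫₀ᵀ 1{X(t) = Xhat(t)} dt]`. -/
def meanBinaryFreshness (X Xhat : ℝ≥0 → Ω → S) (μ : Measure Ω) : ℝ :=
  limsup (fun T : ℝ =>
    (1 / T) * ∫ ω, (∫ t in (0 : ℝ)..T,
      if X t.toNNReal ω = Xhat t.toNNReal ω then (1 : ℝ) else 0) ∂μ) atTop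

/-- The matrix `∫∫ P_{ij}(d + W(i,d) + y) dF^Y(y) dF^D(d)`. -/
def embeddedKernel (Q : Matrix S S ℝ) (W : S → ℝ≥0 → ℝ≥0) (FY FD : Measure ℝ≥0) :
    Matrix S S ℝ :=
  fun i j => ∫ d, ∫ y, transitionMatrix Q ((d : ℝ) + W i d + y) i j ∂FY ∂FD

/-- `φ` solves `∑ᵢ φᵢ Kᵢⱼ = φⱼ` for all `j`, and `∑ᵢ φᵢ = 1`. -/
def IsStationary (K : Matrix S S ℝ) (φ : S → ℝ) : Prop :=
  (∀ j, ∑ i, φ i * K i j = φ j) ∧ ∑ i, φ i = 1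

/-- The joint law of `(X, D', Y, D)`, where the four variables are independent, `X` has
probability mass function `φ`, `D'` and `D` have law `FD`, and `Y` has law `FY`. -/
def cycleLaw (φ : PMF S) (FY FD : Measure ℝ≥0) : Measure (S × ℝ≥0 × ℝ≥0 × ℝ≥0) :=
  φ.toMeasure.prod (FD.prod (FY.prod FD))

end

end QuerySampling

/-! The sampled states behave as a Markov chain with kernel `embeddedKernel`, and the time of
correctness is the reward of a Markov renewal process whose cycles run from one reply to the next.
The limit is obtained without a renewal theorem, from expected numbers of visits alone.

Write S_k for the k-th sampling time, R_k for the k-th reply time and V_T(i) for `visits`. A cycle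
is counted up to T according to its sampling time, not its reply time. The event S_k ≤ T, X(S_k) = i
involves only the path up to S_k and delays other than D_k, Y_{k+1}, D_{k+1}, so conditionally on it
the cycle starts afresh from i. This is `lintegral_cycle`. It needs no strong Markov property: once
the delays are frozen, S_k takes finitely many values, selected by the earlier reported states, and
on each history the Markov property at fixed times applies (`IsCTMC.measure_sampleTime`); the delays
are then integrated out by Fubini. Hence a cycle quantity with mean H(i) from state i has expected
total Σ V_T(i) H(i) over the cycles with S_k ≤ T.

The total N_T = Σ V_T(i) is O(T), because increments truncated at one sum to at most T + 1
(`sum_visits_mul_le`). V_T is invariant under the kernel up to an error of one in each coordinate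
(`visits_le_sum_add_one`). All entries of the kernel are positive, so v ↦ v - vK is bounded below on
vectors of zero mass (`sum_abs_le_of_zero_sum`), and V_T = N_T φ + O(1) follows
(`abs_sum_mul_sub_le`).

The cycles with S_k ≤ T cover the time from R_0 to T and exceed it by a single overshoot of mean at
most b + δ N_T, with δ arbitrarily small (`lintegral_reward_le`, `le_lintegral_reward_add`). Applied
to the indicator of correctness and to the constant one, this expresses the reward up to T and T
itself as N_T times the stationary means of cycle reward and cycle length, up to O(1) + δ N_T. Their
quotient is the limit (`tendsto_reward_rate`). -/

namespace QuerySampling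

/-! ### Stochasticity and positivity of the exponential of a generator -/

section TransitionMatrix

variable {S : Type*} [Fintype S] [DecidableEq S]

open scoped Matrix.Norms.Operator in
theorem hasSum_exp_apply (A : Matrix S S ℝ) (i j : S) :
    HasSum (fun n : ℕ => ((n.factorial : ℝ)⁻¹) * (A ^ n) i j) (NormedSpace.exp A i j) := by
  have h := NormedSpace.exp_series_hasSum_exp' (𝕂 := ℝ) A
  exact ((Pi.hasSum.1 ((Pi.hasSum.1 h) i)) j)

open scoped Matrix.Norms.Operator in
theorem continuous_transitionMatrix (Q : Matrix S S ℝ) (i j : S) :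
    Continuous fun t : ℝ => transitionMatrix Q t i j := by
  have h : Continuous fun t : ℝ => NormedSpace.exp (t • Q) :=
    NormedSpace.exp_continuous.comp (continuous_id.smul continuous_const)
  exact (continuous_apply j).comp ((continuous_apply i).comp h)

theorem transitionMatrix_zero (Q : Matrix S S ℝ) : transitionMatrix Q 0 = 1 := by
  simp [transitionMatrix]

/-- Every power of order at least one ends in a factor with zero row sums, so only the identity term
of the series contributes. -/
theorem transitionMatrix_sum (Q : Matrix S S ℝ) (hQ : IsGenerator Q) (t : ℝ) (i : S) :
    ∑ j, transitionMatrix Q t i j = 1 := by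
  have h : HasSum (fun n : ℕ => ∑ j, ((n.factorial : ℝ)⁻¹) * ((t • Q) ^ n) i j)
      (∑ j, transitionMatrix Q t i j) :=
    hasSum_sum fun j _ => hasSum_exp_apply (t • Q) i j
  have h0 : ∀ n : ℕ, n ≠ 0 → ∑ j, ((n.factorial : ℝ)⁻¹) * ((t • Q) ^ n) i j = 0 := by
    intro n hn
    obtain ⟨m, rfl⟩ := Nat.exists_eq_succ_of_ne_zero hn
    rw [← Finset.mul_sum, pow_succ]
    simp_rw [Matrix.mul_apply]
    rw [Finset.sum_comm]
    simp_rw [← Finset.mul_sum, Matrix.smul_apply, smul_eq_mul, ← Finset.mul_sum, hQ.row_sum]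
    simp
  refine (h.unique (hasSum_single 0 h0)).trans ?_
  simp [Matrix.one_apply]

/-- Adding a large multiple of the identity makes a generator entrywise nonnegative. -/
theorem exists_shift_nonneg (Q : Matrix S S ℝ) (hQ : IsGenerator Q) :
    ∃ c : ℝ, (∀ i j, 0 ≤ (Q + c • (1 : Matrix S S ℝ)) i j) ∧
      ∀ i, 0 < (Q + c • (1 : Matrix S S ℝ)) i i := by
  -- The shift by the sum of all |Q k k| outweighs every diagonal entry; the extra one makes the
  -- diagonal strictly positive.
  have hb : ∀ i, |Q i i| ≤ ∑ k, |Q k k| := fun i =>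
    Finset.single_le_sum (f := fun k => |Q k k|) (fun _ _ => abs_nonneg _) (Finset.mem_univ i)
  have hd : ∀ i, 0 < (Q + ((∑ k, |Q k k|) + 1) • (1 : Matrix S S ℝ)) i i := by
    intro i
    have := neg_abs_le (Q i i)
    simp only [Matrix.add_apply, Matrix.smul_apply, Matrix.one_apply_eq, smul_eq_mul, mul_one]
    linarith [hb i]
  refine ⟨(∑ k, |Q k k|) + 1, fun i j => ?_, hd⟩
  rcases eq_or_ne i j with rfl | hij
  · exact (hd i).le
  · simpa [Matrix.one_apply_ne hij] using hQ.nonneg_of_ne i j hij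

/-- Uniformization: the identity commutes with everything, so the shift only costs a scalar factor,
and signs can be read off a series with nonnegative terms. -/
theorem transitionMatrix_eq_shift (Q : Matrix S S ℝ) (c t : ℝ) (i j : S) :
    transitionMatrix Q t i j =
      Real.exp (-(t * c)) * NormedSpace.exp (t • (Q + c • (1 : Matrix S S ℝ))) i j := by
  have h1 : t • Q = (-(t * c)) • (1 : Matrix S S ℝ) + t • (Q + c • (1 : Matrix S S ℝ)) := by
    rw [smul_add, smul_smul, neg_smul]; abel
  have h2 : NormedSpace.exp ((-(t * c)) • (1 : Matrix S S ℝ))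
      = Real.exp (-(t * c)) • (1 : Matrix S S ℝ) := by
    have : ((-(t * c)) • (1 : Matrix S S ℝ)) = Matrix.diagonal fun _ => -(t * c) := by
      rw [Matrix.smul_one_eq_diagonal]
    rw [this, Matrix.exp_diagonal, Matrix.smul_one_eq_diagonal, Real.exp_eq_exp_ℝ]
    congr 1
    ext k
    rw [Pi.coe_exp]
  rw [transitionMatrix, h1, Matrix.exp_add_of_commute, h2]
  · simp
  · exact ((Commute.one_left _).smul_left _)

theorem pow_entry_nonneg {A : Matrix S S ℝ} (hA : ∀ i j, 0 ≤ A i j) (n : ℕ) (i j : S) :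
    0 ≤ (A ^ n) i j := by
  induction n generalizing i j with
  | zero => simp only [pow_zero, Matrix.one_apply]; split_ifs <;> norm_num
  | succ n ih =>
    rw [pow_succ, Matrix.mul_apply]
    exact Finset.sum_nonneg fun k _ => mul_nonneg (ih i k) (hA k j)

theorem transitionMatrix_nonneg (Q : Matrix S S ℝ) (hQ : IsGenerator Q) {t : ℝ} (ht : 0 ≤ t)
    (i j : S) : 0 ≤ transitionMatrix Q t i j := by
  obtain ⟨c, hc, -⟩ := exists_shift_nonneg Q hQ
  rw [transitionMatrix_eq_shift Q c]
  refine mul_nonneg (Real.exp_pos _).le ((hasSum_exp_apply _ i j).nonneg fun n => ?_)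
  refine mul_nonneg (by positivity) (pow_entry_nonneg (fun i j => ?_) n i j)
  exact mul_nonneg ht (hc i j)

theorem transitionMatrix_le_one (Q : Matrix S S ℝ) (hQ : IsGenerator Q) {t : ℝ} (ht : 0 ≤ t)
    (i j : S) : transitionMatrix Q t i j ≤ 1 := by
  rw [← transitionMatrix_sum Q hQ t i]
  exact Finset.single_le_sum (f := fun j => transitionMatrix Q t i j)
    (fun k _ => transitionMatrix_nonneg Q hQ ht i k) (Finset.mem_univ j)

/-- A chain of n positive rates from i to j makes the (i, j) entry of the n-th power of the shifted
matrix positive, and one positive term of a nonnegative series suffices. This works at every t > 0,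
so periodicity plays no role. -/
theorem transitionMatrix_pos (Q : Matrix S S ℝ) (hQ : IsGenerator Q)
    (hirr : QuerySampling.IsIrreducible Q) {t : ℝ} (ht : 0 < t) (i j : S) :
    0 < transitionMatrix Q t i j := by
  obtain ⟨c, hc, hd⟩ := exists_shift_nonneg Q hQ
  set A := Q + c • (1 : Matrix S S ℝ) with hA
  have hpow : ∃ n : ℕ, 0 < (A ^ n) i j := by
    induction hirr i j using Relation.ReflTransGen.head_induction_on with
    | refl => exact ⟨0, by simp⟩
    | @head a b hab _ ih =>
      obtain ⟨n, hn⟩ := ih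
      refine ⟨n + 1, ?_⟩
      rw [pow_succ', Matrix.mul_apply]
      refine Finset.sum_pos' (fun k _ => mul_nonneg (hc a k) (pow_entry_nonneg hc n k j))
        ⟨b, Finset.mem_univ b, mul_pos ?_ hn⟩
      rcases eq_or_ne a b with rfl | hne
      · exact hd a
      · simpa [hA, Matrix.one_apply_ne hne] using hab
  obtain ⟨n, hn⟩ := hpow
  rw [transitionMatrix_eq_shift Q c]
  refine mul_pos (Real.exp_pos _) ?_
  have h := hasSum_exp_apply (t • A) i j
  have hnn : ∀ m : ℕ, 0 ≤ ((m.factorial : ℝ)⁻¹) * ((t • A) ^ m) i j := fun m =>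
    mul_nonneg (by positivity)
      (pow_entry_nonneg (fun i j => mul_nonneg ht.le (hc i j)) m i j)
  refine lt_of_lt_of_le ?_ (le_hasSum h n fun m _ => hnn m)
  rw [smul_pow, Matrix.smul_apply, smul_eq_mul]
  positivity

end TransitionMatrix

/-! ### The stationary law of a strictly positive stochastic matrix -/

section Stationary

variable {S : Type*} [Fintype S]

/-- Doeblin's argument: against a vector of zero mass, ε can be subtracted from every entry of K at
no cost, and the remaining nonnegative matrix has row sums 1 - |S| ε. -/
theorem sum_abs_vecMul_le {K : Matrix S S ℝ} {ε : ℝ} (hK : ∀ i j, ε ≤ K i j)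
    (hsum : ∀ i, ∑ j, K i j = 1) {v : S → ℝ} (hv : ∑ i, v i = 0) :
    ∑ j, |∑ i, v i * K i j| ≤ (1 - Fintype.card S * ε) * ∑ i, |v i| := by
  have h1 : ∀ j, |∑ i, v i * K i j| ≤ ∑ i, |v i| * (K i j - ε) := by
    intro j
    have : ∑ i, v i * K i j = ∑ i, v i * (K i j - ε) := by
      simp_rw [mul_sub]
      rw [Finset.sum_sub_distrib, ← Finset.sum_mul, hv]; simp
    rw [this]
    refine (Finset.abs_sum_le_sum_abs _ _).trans (Finset.sum_le_sum fun i _ => ?_)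
    rw [abs_mul, abs_of_nonneg (sub_nonneg.2 (hK i j))]
  refine (Finset.sum_le_sum fun j _ => h1 j).trans ?_
  rw [Finset.sum_comm, Finset.mul_sum]
  refine Finset.sum_le_sum fun i _ => ?_
  rw [← Finset.mul_sum, Finset.sum_sub_distrib, hsum]
  simp [mul_comm]

/-- On vectors of total mass zero, `v ↦ v - v K` is bounded below if `K` is a strictly positive
stochastic matrix. -/
theorem sum_abs_le_of_zero_sum {K : Matrix S S ℝ} {ε : ℝ} (hK : ∀ i j, ε ≤ K i j)
    (hsum : ∀ i, ∑ j, K i j = 1) {v : S → ℝ} (hv : ∑ i, v i = 0) :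
    Fintype.card S * ε * ∑ i, |v i| ≤ ∑ j, |v j - ∑ i, v i * K i j| := by
  have h1 := sum_abs_vecMul_le hK hsum hv
  have h2 : ∑ j, |v j| ≤ ∑ j, (|v j - ∑ i, v i * K i j| + |∑ i, v i * K i j|) :=
    Finset.sum_le_sum fun j _ => by
      simpa using abs_add_le (v j - ∑ i, v i * K i j) (∑ i, v i * K i j)
  rw [Finset.sum_add_distrib] at h2
  linarith

variable [Nonempty S] {K : Matrix S S ℝ} {ε : ℝ}

theorem eq_zero_of_zero_sum (hε : 0 < ε) (hK : ∀ i j, ε ≤ K i j)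
    (hsum : ∀ i, ∑ j, K i j = 1) {v : S → ℝ} (hv : ∑ i, v i = 0)
    (hst : ∀ j, ∑ i, v i * K i j = v j) : v = 0 := by
  have h := sum_abs_le_of_zero_sum hK hsum hv
  simp only [hst, sub_self, abs_zero, Finset.sum_const_zero] at h
  have hc : (0 : ℝ) < Fintype.card S * ε := by
    have : (0 : ℝ) < Fintype.card S := by exact_mod_cast Fintype.card_pos
    positivity
  have h0 : ∑ i, |v i| ≤ 0 := by
    by_contra! hpos
    exact absurd h (not_le.2 (mul_pos hc hpos))
  have h1 := (Finset.sum_eq_zero_iff_of_nonneg fun i _ => abs_nonneg (v i)).1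
    (le_antisymm h0 (Finset.sum_nonneg fun i _ => abs_nonneg _))
  ext i
  simpa using h1 i (Finset.mem_univ i)

theorem IsStationary.unique (hε : 0 < ε) (hK : ∀ i j, ε ≤ K i j)
    (hsum : ∀ i, ∑ j, K i j = 1) {φ ψ : S → ℝ} (hφ : IsStationary K φ) (hψ : IsStationary K ψ) :
    ψ = φ := by
  refine sub_eq_zero.1 (eq_zero_of_zero_sum hε hK hsum (v := ψ - φ) ?_ fun j => ?_)
  · simp [Finset.sum_sub_distrib, hφ.2, hψ.2]
  · simp [sub_mul, Finset.sum_sub_distrib, hφ.1, hψ.1]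

/-- K fixes the constant vector, so 1 - K is singular and has a left null vector v. Then |v| ≤ |v| K
entrywise with equal total masses, hence equality, and |v| is normalized. -/
theorem exists_isStationary [DecidableEq S] (hε : 0 < ε) (hK : ∀ i j, ε ≤ K i j)
    (hsum : ∀ i, ∑ j, K i j = 1) : ∃ φ : S → ℝ, IsStationary K φ ∧ ∀ i, 0 ≤ φ i := by
  have hdet : (1 - K).det = 0 := by
    refine Matrix.exists_mulVec_eq_zero_iff.1 ⟨1, one_ne_zero, ?_⟩
    ext i
    rw [Matrix.sub_mulVec, Matrix.one_mulVec]
    simp [Matrix.mulVec, dotProduct, hsum]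
  obtain ⟨v, hv0, hv⟩ := Matrix.exists_vecMul_eq_zero_iff.2 hdet
  have hst : ∀ j, ∑ i, v i * K i j = v j := by
    intro j
    have := congrFun hv j
    simp only [Matrix.vecMul_sub, Matrix.vecMul_one, Pi.sub_apply, Pi.zero_apply] at this
    simp only [Matrix.vecMul, dotProduct] at this
    linarith
  have hle : ∀ j, |v j| ≤ ∑ i, |v i| * K i j := by
    intro j
    conv_lhs => rw [← hst j]
    refine (Finset.abs_sum_le_sum_abs _ _).trans (Finset.sum_le_sum fun i _ => ?_)
    rw [abs_mul, abs_of_nonneg (hε.le.trans (hK i j))]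
  have htot : ∑ j, |v j| = ∑ j, ∑ i, |v i| * K i j := by
    rw [Finset.sum_comm]
    simp [← Finset.mul_sum, hsum]
  have heq : ∀ j, ∑ i, |v i| * K i j = |v j| := fun j =>
    ((Finset.sum_eq_sum_iff_of_le fun j _ => hle j).1 htot j (Finset.mem_univ j)).symm
  have hpos : 0 < ∑ i, |v i| := by
    obtain ⟨i, hi⟩ := Function.ne_iff.1 hv0
    exact Finset.sum_pos' (fun _ _ => abs_nonneg _) ⟨i, Finset.mem_univ i, abs_pos.2 hi⟩
  refine ⟨fun i => |v i| / ∑ i, |v i|, ⟨fun j => ?_, ?_⟩, fun i => by positivity⟩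
  · simp_rw [div_mul_eq_mul_div]
    rw [← Finset.sum_div, heq]
  · rw [← Finset.sum_div, div_self hpos.ne']

end Stationary

/-! ### Joint measurability of paths, sampling times and estimate -/

section Measurability

variable {S : Type*} [Fintype S] [MeasurableSpace S] [DiscreteMeasurableSpace S]
variable {Ω : Type*} [MeasurableSpace Ω]

/-- Approximation of a time from the right by grid points. -/
theorem exists_grid_approximation : ∃ g : ℕ → ℝ≥0 → ℝ≥0,
    (∀ n, ∃ (q : ℕ → ℝ≥0) (f : ℝ≥0 → ℕ), Measurable f ∧ ∀ t, g n t = q (f t)) ∧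
      ∀ t, Tendsto (fun n => g n t) atTop (𝓝[>] t) := by
  -- The `+ 1` in the numerator puts the grid point strictly to the right of t, as convergence in
  -- `𝓝[>] t` demands.
  let g : ℕ → ℝ≥0 → ℝ≥0 := fun n t => (⌊t * (n + 1)⌋₊ + 1) / (n + 1)
  have hg_gt : ∀ n t, t < g n t := by
    intro n t
    have hn : (0 : ℝ≥0) < n + 1 := by positivity
    rw [lt_div_iff₀ hn]
    exact Nat.lt_floor_add_one _
  have hg_le : ∀ n t, g n t ≤ t + 1 / (n + 1) := by
    intro n t
    have hn : (0 : ℝ≥0) < n + 1 := by positivity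
    have h1 : (⌊t * (n + 1)⌋₊ : ℝ≥0) ≤ t * (n + 1) := Nat.floor_le (zero_le)
    simp only [g]
    rw [div_le_iff₀ hn, add_mul, one_div, inv_mul_cancel₀ hn.ne']
    gcongr
  refine ⟨g, fun n => ⟨fun k => (k + 1) / (n + 1), fun t => ⌊t * (n + 1)⌋₊,
    Nat.measurable_floor.comp (measurable_id.mul_const _), fun t => rfl⟩, fun t => ?_⟩
  refine tendsto_nhdsWithin_iff.2 ⟨?_, Eventually.of_forall fun n => hg_gt n t⟩
  refine tendsto_of_tendsto_of_tendsto_of_le_of_le tendsto_const_nhds ?_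
    (fun n => (hg_gt n t).le) (fun n => hg_le n t)
  have : Tendsto (fun n : ℕ => t + 1 / ((n : ℝ≥0) + 1)) atTop (𝓝 (t + 0)) :=
    tendsto_const_nhds.add tendsto_one_div_add_atTop_nhds_zero_nat
  simpa using this

-- The states are discrete, so along grid points decreasing to t the path is eventually equal to its
-- value at t. The preimage of a state is thus a countable limit inferior of measurable sets.
omit [Fintype S] in
theorem measurable_uncurry_of_rightContinuous [Countable S] {X : ℝ≥0 → Ω → S}
    (hm : ∀ t, Measurable (X t)) (hr : ∀ ω t, ∀ᶠ s in 𝓝[>] t, X s ω = X t ω) :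
    Measurable fun p : ℝ≥0 × Ω => X p.1 p.2 := by
  obtain ⟨g, hgq, hg⟩ := exists_grid_approximation
  have hgm : ∀ n, Measurable fun p : ℝ≥0 × Ω => X (g n p.1) p.2 := by
    intro n
    obtain ⟨q, f, hf, hgf⟩ := hgq n
    have h1 : Measurable fun r : ℕ × Ω => X (q r.1) r.2 :=
      measurable_from_prod_countable_right fun k => hm (q k)
    have h2 : Measurable fun p : ℝ≥0 × Ω => (f p.1, p.2) :=
      (hf.comp measurable_fst).prodMk measurable_snd
    simp_rw [hgf]
    exact h1.comp h2
  refine measurable_to_countable' fun j => ?_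
  have hset : (fun p : ℝ≥0 × Ω => X p.1 p.2) ⁻¹' {j}
      = {p | ∀ᶠ n in atTop, X (g n p.1) p.2 = j} := by
    ext p
    have he : ∀ᶠ n in atTop, X (g n p.1) p.2 = X p.1 p.2 := (hg p.1).eventually (hr p.2 p.1)
    simp only [Set.mem_preimage, Set.mem_singleton_iff, Set.mem_ofPred_eq]
    constructor
    · intro h
      filter_upwards [he] with n hn
      rw [hn, h]
    · intro h
      obtain ⟨n, h1, h2⟩ := (he.and h).exists
      rw [← h1, h2]
  rw [hset]
  simp only [eventually_atTop, Set.ofPred_exists, Set.ofPred_forall]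
  exact MeasurableSet.iUnion fun N => MeasurableSet.iInter fun n => MeasurableSet.iInter fun _ =>
    hgm n (measurableSet_singleton j)

variable {X : ℝ≥0 → Ω → S} {Y D : ℕ → Ω → ℝ≥0} {W : S → ℝ≥0 → ℝ≥0} {t₀ : ℝ≥0}

theorem measurable_sampleTime (hX : Measurable fun p : ℝ≥0 × Ω => X p.1 p.2)
    (hY : ∀ k, Measurable (Y k)) (hD : ∀ k, Measurable (D k)) (hW : ∀ i, Measurable (W i))
    (k : ℕ) : Measurable (sampleTime X Y D W t₀ k) := by
  induction k with
  | zero => exact (hY 0).const_add t₀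
  | succ k ih =>
    have hW' : Measurable fun q : S × ℝ≥0 => W q.1 q.2 :=
      measurable_from_prod_countable_right hW
    have hXS : Measurable fun ω => X (sampleTime X Y D W t₀ k ω) ω :=
      hX.comp (ih.prodMk measurable_id)
    exact ((ih.add (hD k)).add (hW'.comp (hXS.prodMk (hD k)))).add (hY (k + 1))

theorem measurable_replyTime (hX : Measurable fun p : ℝ≥0 × Ω => X p.1 p.2)
    (hY : ∀ k, Measurable (Y k)) (hD : ∀ k, Measurable (D k)) (hW : ∀ i, Measurable (W i))
    (k : ℕ) : Measurable (replyTime X Y D W t₀ k) :=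
  (measurable_sampleTime hX hY hD hW k).add (hD k)

theorem measurable_sampledState (hX : Measurable fun p : ℝ≥0 × Ω => X p.1 p.2)
    (hY : ∀ k, Measurable (Y k)) (hD : ∀ k, Measurable (D k)) (hW : ∀ i, Measurable (W i))
    (k : ℕ) : Measurable fun ω => X (sampleTime X Y D W t₀ k ω) ω :=
  hX.comp ((measurable_sampleTime hX hY hD hW k).prodMk measurable_id)

omit [Fintype S] [MeasurableSpace S] [DiscreteMeasurableSpace S] [MeasurableSpace Ω] in
theorem replyTime_succ (k : ℕ) (ω : Ω) :
    replyTime X Y D W t₀ (k + 1) ω = replyTime X Y D W t₀ k ω +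
      (W (X (sampleTime X Y D W t₀ k ω) ω) (D k ω) + Y (k + 1) ω + D (k + 1) ω) := by
  simp only [replyTime, sampleTime, add_assoc]

omit [Fintype S] [MeasurableSpace S] [DiscreteMeasurableSpace S] [MeasurableSpace Ω] in
theorem sampleTime_succ (k : ℕ) (ω : Ω) :
    sampleTime X Y D W t₀ (k + 1) ω = sampleTime X Y D W t₀ k ω +
      (D k ω + W (X (sampleTime X Y D W t₀ k ω) ω) (D k ω) + Y (k + 1) ω) := by
  simp only [sampleTime, add_assoc]

omit [Fintype S] [MeasurableSpace S] [DiscreteMeasurableSpace S] [MeasurableSpace Ω] in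
theorem monotone_sampleTime (ω : Ω) : Monotone fun k => sampleTime X Y D W t₀ k ω :=
  monotone_nat_of_le_succ fun k => by rw [sampleTime_succ]; exact le_self_add

omit [Fintype S] [MeasurableSpace S] [DiscreteMeasurableSpace S] [MeasurableSpace Ω] in
theorem monotone_replyTime (ω : Ω) : Monotone fun k => replyTime X Y D W t₀ k ω :=
  monotone_nat_of_le_succ fun k => by rw [replyTime_succ]; exact le_self_add

omit [Fintype S] [MeasurableSpace S] [DiscreteMeasurableSpace S] [MeasurableSpace Ω] in
theorem lastReply_eq {k : ℕ} {t : ℝ≥0} {ω : Ω} (h1 : replyTime X Y D W t₀ k ω ≤ t)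
    (h2 : t < replyTime X Y D W t₀ (k + 1) ω) : lastReply X Y D W t₀ t ω = k := by
  refine IsGreatest.csSup_eq ⟨h1, fun l (hl : _ ≤ t) => ?_⟩
  by_contra! hlt
  exact absurd ((monotone_replyTime ω hlt).trans hl) (not_le.2 h2)

-- Only positive indices are characterized: `sSup` in ℕ is 0 on empty and on unbounded sets, so the
-- value 0 is ambiguous and is treated as a complement in `measurable_lastReply`.
omit [Fintype S] [MeasurableSpace S] [DiscreteMeasurableSpace S] [MeasurableSpace Ω] in
theorem lastReply_eq_succ_iff (k : ℕ) (t : ℝ≥0) (ω : Ω) :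
    lastReply X Y D W t₀ t ω = k + 1 ↔
      replyTime X Y D W t₀ (k + 1) ω ≤ t ∧ t < replyTime X Y D W t₀ (k + 2) ω := by
  refine ⟨fun h => ?_, fun h => lastReply_eq h.1 h.2⟩
  have hbdd : BddAbove {l : ℕ | replyTime X Y D W t₀ l ω ≤ t} := by
    by_contra hb
    rw [lastReply, csSup_of_not_bddAbove hb] at h
    simp at h
  have hne : {l : ℕ | replyTime X Y D W t₀ l ω ≤ t}.Nonempty := by
    by_contra hb
    rw [Set.not_nonempty_iff_eq_empty] at hb
    rw [lastReply, hb] at h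
    simp at h
  have hmem := Nat.sSup_mem hne hbdd
  rw [lastReply] at h
  refine ⟨by rw [h] at hmem; exact hmem, ?_⟩
  by_contra! hle
  have := le_csSup hbdd hle
  omega

theorem measurable_lastReply (hX : Measurable fun p : ℝ≥0 × Ω => X p.1 p.2)
    (hY : ∀ k, Measurable (Y k)) (hD : ∀ k, Measurable (D k)) (hW : ∀ i, Measurable (W i)) :
    Measurable fun p : ℝ≥0 × Ω => lastReply X Y D W t₀ p.1 p.2 := by
  have hR := fun k => measurable_replyTime (t₀ := t₀) hX hY hD hW k
  have hsucc : ∀ k, MeasurableSet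
      ((fun p : ℝ≥0 × Ω => lastReply X Y D W t₀ p.1 p.2) ⁻¹' {k + 1}) := by
    intro k
    have : (fun p : ℝ≥0 × Ω => lastReply X Y D W t₀ p.1 p.2) ⁻¹' {k + 1} =
        {p | replyTime X Y D W t₀ (k + 1) p.2 ≤ p.1} ∩
          {p | p.1 < replyTime X Y D W t₀ (k + 2) p.2} := by
      ext p
      exact lastReply_eq_succ_iff k p.1 p.2
    rw [this]
    exact (measurableSet_le ((hR _).comp measurable_snd) measurable_fst).inter
      (measurableSet_lt measurable_fst ((hR _).comp measurable_snd))
  refine measurable_to_countable' fun k => ?_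
  rcases k with _ | k
  · have : (fun p : ℝ≥0 × Ω => lastReply X Y D W t₀ p.1 p.2) ⁻¹' {0} =
        (⋃ k, (fun p : ℝ≥0 × Ω => lastReply X Y D W t₀ p.1 p.2) ⁻¹' {k + 1})ᶜ := by
      ext p
      simp only [Set.mem_preimage, Set.mem_singleton_iff, Set.mem_compl_iff, Set.mem_iUnion,
        not_exists]
      constructor
      · intro h k; omega
      · intro h
        by_contra h0
        obtain ⟨m, hm⟩ := Nat.exists_eq_succ_of_ne_zero h0
        exact h m hm
    rw [this]
    exact (MeasurableSet.iUnion hsucc).compl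
  · exact hsucc k

theorem measurable_estimate (hX : Measurable fun p : ℝ≥0 × Ω => X p.1 p.2)
    (hY : ∀ k, Measurable (Y k)) (hD : ∀ k, Measurable (D k)) (hW : ∀ i, Measurable (W i))
    {e₀ : ℝ≥0 → S} (he₀ : Measurable e₀) {e : S → ℝ≥0 → S} (he : ∀ i, Measurable (e i)) :
    Measurable fun p : ℝ≥0 × Ω => estimate X Y D W t₀ e₀ e p.1 p.2 := by
  have hR := measurable_replyTime (t₀ := t₀) hX hY hD hW 0
  have hL := measurable_lastReply (t₀ := t₀) hX hY hD hW
  have hS : Measurable fun p : ℝ≥0 × Ω =>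
      sampleTime X Y D W t₀ (lastReply X Y D W t₀ p.1 p.2) p.2 := by
    have h1 : Measurable fun q : ℕ × Ω => sampleTime X Y D W t₀ q.1 q.2 :=
      measurable_from_prod_countable_right fun k => measurable_sampleTime hX hY hD hW k
    exact h1.comp (hL.prodMk measurable_snd)
  have he' : Measurable fun q : S × ℝ≥0 => e q.1 q.2 := measurable_from_prod_countable_right he
  refine Measurable.ite (measurableSet_lt measurable_fst (hR.comp measurable_snd))
    (he₀.comp measurable_fst) ?_
  exact he'.comp ((hX.comp (hS.prodMk measurable_snd)).prodMk (measurable_fst.sub hS))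

end Measurability

/-! ### What the sampling times depend on -/

section Congr

variable {S Ω Ω' : Type*} {X : ℝ≥0 → Ω → S} {Y D : ℕ → Ω → ℝ≥0} {X' : ℝ≥0 → Ω' → S}
  {Y' D' : ℕ → Ω' → ℝ≥0} {W : S → ℝ≥0 → ℝ≥0} {t₀ : ℝ≥0} {ω : Ω} {ω' : Ω'}

/-- The sampling times depend on the path and on the earlier delays only. -/
theorem sampleTime_congr (hX : ∀ t, X t ω = X' t ω') (k : ℕ) (hY : ∀ l ≤ k, Y l ω = Y' l ω')
    (hD : ∀ l < k, D l ω = D' l ω') :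
    sampleTime X Y D W t₀ k ω = sampleTime X' Y' D' W t₀ k ω' := by
  induction k with
  | zero => simp [sampleTime, hY 0 le_rfl]
  | succ k ih =>
    rw [sampleTime, sampleTime, ih (fun l hl => hY l (hl.trans k.le_succ))
      (fun l hl => hD l (hl.trans k.lt_succ_self)), hY (k + 1) le_rfl, hD k k.lt_succ_self, hX]

end Congr

/-! ### The Markov property at the sampling times, with frozen delays -/

section FixedDelays

/-- The sampling times when the reported states are prescribed. -/
def scheduledTime {S : Type*} (W : S → ℝ≥0 → ℝ≥0) (t₀ : ℝ≥0) (y d : ℕ → ℝ≥0) (x : ℕ → S) :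
    ℕ → ℝ≥0
  | 0 => t₀ + y 0
  | k + 1 => scheduledTime W t₀ y d x k + d k + W (x k) (d k) + y (k + 1)

section Deterministic

variable {S Ω : Type*} {X : ℝ≥0 → Ω → S} {W : S → ℝ≥0 → ℝ≥0} {t₀ : ℝ≥0} {y d : ℕ → ℝ≥0}
  {x : ℕ → S} {ω : Ω}

theorem monotone_scheduledTime : Monotone (scheduledTime W t₀ y d x) :=
  monotone_nat_of_le_succ fun k => by
    rw [scheduledTime, add_assoc, add_assoc]; exact le_self_add

theorem sampleTime_eq_scheduledTime (k : ℕ)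
    (h : ∀ l < k, X (sampleTime X (fun n _ => y n) (fun n _ => d n) W t₀ l ω) ω = x l) :
    sampleTime X (fun n _ => y n) (fun n _ => d n) W t₀ k ω = scheduledTime W t₀ y d x k := by
  induction k with
  | zero => rfl
  | succ k ih =>
    rw [sampleTime, scheduledTime, h k k.lt_succ_self,
      ih fun l hl => h l (hl.trans k.lt_succ_self)]

theorem sampleTime_eq_scheduledTime' (k : ℕ)
    (h : ∀ l < k, X (scheduledTime W t₀ y d x l) ω = x l) :
    sampleTime X (fun n _ => y n) (fun n _ => d n) W t₀ k ω = scheduledTime W t₀ y d x k := by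
  induction k with
  | zero => rfl
  | succ k ih =>
    have ih' := ih fun l hl => h l (hl.trans k.lt_succ_self)
    rw [sampleTime, scheduledTime, ih', h k k.lt_succ_self]

/-- Random and scheduled times coincide as long as the states observed so far are the prescribed
ones. The event is thereby expressed at deterministic times, where the Markov property is available.
-/
theorem forall_sampledState_iff (k : ℕ) :
    (∀ l ≤ k, X (sampleTime X (fun n _ => y n) (fun n _ => d n) W t₀ l ω) ω = x l) ↔
      ∀ l ≤ k, X (scheduledTime W t₀ y d x l) ω = x l := by
  constructor
  · intro h l hl
    rw [← sampleTime_eq_scheduledTime (ω := ω) (X := X) l fun m hm => h m (hm.le.trans hl)]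
    exact h l hl
  · intro h l hl
    rw [sampleTime_eq_scheduledTime' (ω := ω) (X := X) l fun m hm => h m (hm.le.trans hl)]
    exact h l hl

end Deterministic

theorem measure_eq_sum_fiber {Ω B : Type*} [MeasurableSpace Ω] [Fintype B] (μ : Measure Ω)
    (F : Ω → B) (hF : ∀ b, MeasurableSet (F ⁻¹' {b})) (E : Set Ω) :
    μ E = ∑ b, μ (E ∩ F ⁻¹' {b}) := by
  have h := sum_measure_preimage_singleton (μ := μ.restrict E) Finset.univ (f := F)
    (fun b _ => hF b)
  simp only [Finset.coe_univ, Set.preimage_univ, Measure.restrict_apply_univ] at h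
  rw [← h]
  refine Finset.sum_congr rfl fun b _ => ?_
  rw [Measure.restrict_apply (hF b), Set.inter_comm]

variable {S : Type*} [Fintype S] [DecidableEq S] [MeasurableSpace S] [DiscreteMeasurableSpace S]
variable {Ω : Type*} [MeasurableSpace Ω] {μ : Measure Ω} [IsProbabilityMeasure μ]
  {Q : Matrix S S ℝ} {X : ℝ≥0 → Ω → S}

omit [DiscreteMeasurableSpace S] in
theorem IsCTMC.measure_markov (hX : IsCTMC Q X μ) (k : ℕ) (s : ℕ → ℝ≥0) (hs : Monotone s)
    (x : ℕ → S) (u : ℝ≥0) (j : S) :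
    μ {ω | (∀ l ≤ k, X (s l) ω = x l) ∧ X (s k + u) ω = j} =
      μ {ω | ∀ l ≤ k, X (s l) ω = x l} * ENNReal.ofReal (transitionMatrix Q u (x k) j) := by
  -- All times after index k are set to s k + u: the sequence stays monotone and only index k + 1 is
  -- used.
  have hmono : Monotone fun l => if l ≤ k then s l else s k + u := by
    intro a b hab
    by_cases hb : b ≤ k
    · simpa [hb, hab.trans hb] using hs hab
    · by_cases ha : a ≤ k
      · simpa [ha, hb] using (hs ha).trans le_self_add
      · simp [ha, hb]
  have h := hX.markov k _ hmono fun l => if l ≤ k then x l else j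
  have e1 : {ω | ∀ l ≤ k + 1, X (if l ≤ k then s l else s k + u) ω = if l ≤ k then x l else j}
      = {ω | (∀ l ≤ k, X (s l) ω = x l) ∧ X (s k + u) ω = j} := by
    ext ω
    simp only [Set.mem_ofPred_eq]
    constructor
    · intro h
      refine ⟨fun l hl => ?_, ?_⟩
      · have := h l (hl.trans k.le_succ)
        simpa [hl] using this
      · simpa using h (k + 1) le_rfl
    · rintro ⟨h1, h2⟩ l hl
      by_cases hlk : l ≤ k
      · simpa [hlk] using h1 l hlk
      · simpa [hlk] using h2
  have e2 : {ω | ∀ l ≤ k, X (if l ≤ k then s l else s k + u) ω = if l ≤ k then x l else j}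
      = {ω | ∀ l ≤ k, X (s l) ω = x l} := by
    ext ω
    refine forall_congr' fun l => forall_congr' fun hl => ?_
    simp [hl]
  rw [e1, e2] at h
  simp only [le_refl, if_true, Nat.not_succ_le_self, if_false, NNReal.coe_add,
    add_sub_cancel_left] at h
  rw [← ofReal_measureReal, h, ENNReal.ofReal_mul measureReal_nonneg, ofReal_measureReal]

variable {W : S → ℝ≥0 → ℝ≥0} {t₀ : ℝ≥0}

/-- The Markov property at the sampling times, for deterministic delays. -/
theorem IsCTMC.measure_sampleTime (hX : IsCTMC Q X μ) (hW : ∀ i, Measurable (W i))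
    (y d : ℕ → ℝ≥0) (k : ℕ) (T u : ℝ≥0) (i j : S) :
    μ {ω | (sampleTime X (fun n _ => y n) (fun n _ => d n) W t₀ k ω ≤ T ∧
        X (sampleTime X (fun n _ => y n) (fun n _ => d n) W t₀ k ω) ω = i) ∧
        X (sampleTime X (fun n _ => y n) (fun n _ => d n) W t₀ k ω + u) ω = j} =
      μ {ω | sampleTime X (fun n _ => y n) (fun n _ => d n) W t₀ k ω ≤ T ∧
        X (sampleTime X (fun n _ => y n) (fun n _ => d n) W t₀ k ω) ω = i} *
      ENNReal.ofReal (transitionMatrix Q u i j) := by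
  set st := sampleTime X (fun n _ => y n) (fun n _ => d n) W t₀ with hst
  have hXm := measurable_uncurry_of_rightContinuous hX.measurable hX.right_continuous
  have hsm : ∀ l, Measurable fun ω => X (st l ω) ω := fun l =>
    measurable_sampledState hXm (fun _ => measurable_const) (fun _ => measurable_const) hW l
  -- F records the history of reported states. It has finitely many values, and on each of its
  -- fibres the sampling time is the constant `scheduledTime`.
  let F : Ω → (Fin (k + 1) → S) := fun ω l => X (st l ω) ω
  have hF : ∀ b, MeasurableSet (F ⁻¹' {b}) := fun b =>
    measurableSet_preimage (measurable_pi_lambda _ fun l => hsm l) (measurableSet_singleton b)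
  rw [measure_eq_sum_fiber μ F hF, measure_eq_sum_fiber μ F hF {ω | st k ω ≤ T ∧ _},
    Finset.sum_mul]
  refine Finset.sum_congr rfl fun b _ => ?_
  let x : ℕ → S := fun l => if h : l ≤ k then b ⟨l, Nat.lt_succ_of_le h⟩ else i
  have hfib : ∀ ω, ω ∈ F ⁻¹' {b} ↔ ∀ l ≤ k, X (scheduledTime W t₀ y d x l) ω = x l := by
    intro ω
    rw [← forall_sampledState_iff, Set.mem_preimage, Set.mem_singleton_iff, funext_iff]
    constructor
    · intro h l hl
      have := h ⟨l, Nat.lt_succ_of_le hl⟩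
      simpa [F, x, hl] using this
    · intro h l
      have := h l (Nat.le_of_lt_succ l.2)
      simpa [F, x, Nat.le_of_lt_succ l.2] using this
  have hk : ∀ ω ∈ F ⁻¹' {b}, st k ω = scheduledTime W t₀ y d x k := fun ω hω =>
    sampleTime_eq_scheduledTime' k fun l hl => (hfib ω).1 hω l hl.le
  have hkx : ∀ ω ∈ F ⁻¹' {b}, X (st k ω) ω = x k := fun ω hω => by
    rw [hk ω hω]; exact (hfib ω).1 hω k le_rfl
  -- On a fibre both conditions of the event are constant: either they hold throughout, or the fibre
  -- contributes zero to both sides.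
  by_cases hc : scheduledTime W t₀ y d x k ≤ T ∧ x k = i
  · have e1 : {ω | (st k ω ≤ T ∧ X (st k ω) ω = i) ∧ X (st k ω + u) ω = j} ∩ F ⁻¹' {b} =
        {ω | (∀ l ≤ k, X (scheduledTime W t₀ y d x l) ω = x l) ∧
          X (scheduledTime W t₀ y d x k + u) ω = j} := by
      ext ω
      constructor
      · rintro ⟨⟨-, h⟩, hω⟩
        exact ⟨(hfib ω).1 hω, by rw [← hk ω hω]; exact h⟩
      · rintro ⟨h1, h2⟩
        have hω := (hfib ω).2 h1
        exact ⟨⟨⟨by rw [hk ω hω]; exact hc.1, by rw [hkx ω hω]; exact hc.2⟩,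
          by rw [hk ω hω]; exact h2⟩, hω⟩
    have e2 : {ω | st k ω ≤ T ∧ X (st k ω) ω = i} ∩ F ⁻¹' {b} =
        {ω | ∀ l ≤ k, X (scheduledTime W t₀ y d x l) ω = x l} := by
      ext ω
      constructor
      · rintro ⟨-, hω⟩
        exact (hfib ω).1 hω
      · intro h1
        have hω := (hfib ω).2 h1
        exact ⟨⟨by rw [hk ω hω]; exact hc.1, by rw [hkx ω hω]; exact hc.2⟩, hω⟩
    rw [e1, e2, hX.measure_markov k _ monotone_scheduledTime, hc.2]
  · have hempty : {ω | st k ω ≤ T ∧ X (st k ω) ω = i} ∩ F ⁻¹' {b} = ∅ := by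
      ext ω
      simp only [Set.mem_inter_iff, Set.mem_ofPred_eq, Set.mem_empty_iff_false, iff_false]
      rintro ⟨⟨h1, h2⟩, hω⟩
      exact hc ⟨by rw [← hk ω hω]; exact h1, by rw [← hkx ω hω]; exact h2⟩
    have hempty' : {ω | (st k ω ≤ T ∧ X (st k ω) ω = i) ∧ X (st k ω + u) ω = j} ∩ F ⁻¹' {b}
        = ∅ :=
      Set.subset_eq_empty (Set.inter_subset_inter_left _ fun ω h => h.1) hempty
    rw [hempty, hempty']
    simp

end FixedDelays

/-! ### The cycle identity -/

section Cycle

variable {S : Type*} [MeasurableSpace S]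
variable {Ω : Type*} [MeasurableSpace Ω] {μ : Measure Ω} [IsProbabilityMeasure μ]
  {X : ℝ≥0 → Ω → S} {Y D : ℕ → Ω → ℝ≥0} {FY FD : Measure ℝ≥0}

omit [IsProbabilityMeasure μ] in
theorem IsDelaySequence.measurable_elim (hYD : IsDelaySequence X Y D FY FD μ) (m : ℕ ⊕ ℕ) :
    Measurable fun ω => Sum.elim Y D m ω := by
  cases m with
  | inl k => exact hYD.measurable_forward k
  | inr k => exact hYD.measurable_backward k

theorem IsDelaySequence.map_cycle (hYD : IsDelaySequence X Y D FY FD μ) (k : ℕ) :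
    μ.map (fun ω => (D k ω, Y (k + 1) ω, D (k + 1) ω)) = FD.prod (FY.prod FD) := by
  have h1 : IndepFun (D k) (fun ω => (Y (k + 1) ω, D (k + 1) ω)) μ :=
    (hYD.indep_delays.indepFun_prodMk hYD.measurable_elim (.inl (k + 1)) (.inr (k + 1)) (.inr k)
      (by simp) (by simp)).symm
  have h2 : IndepFun (Y (k + 1)) (D (k + 1)) μ :=
    hYD.indep_delays.indepFun (i := .inl (k + 1)) (j := .inr (k + 1)) (by simp)
  have hY := hYD.measurable_forward
  have hD := hYD.measurable_backward
  rw [(indepFun_iff_map_prod_eq_prod_map_map (hD k).aemeasurable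
      ((hY _).prodMk (hD _)).aemeasurable).1 h1,
    (indepFun_iff_map_prod_eq_prod_map_map (hY _).aemeasurable (hD _).aemeasurable).1 h2,
    hYD.law_backward, hYD.law_forward, hYD.law_backward]

/-- The delays of the current cycle are independent of the earlier ones. -/
theorem IsDelaySequence.lintegral_past_mul_cycle (hYD : IsDelaySequence X Y D FY FD μ) (k : ℕ)
    {A : (ℕ ⊕ ℕ → ℝ≥0) → ENNReal} (hA : Measurable A)
    (hpast : ∀ δ δ' : ℕ ⊕ ℕ → ℝ≥0, (∀ l ≤ k, δ (.inl l) = δ' (.inl l)) →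
      (∀ l < k, δ (.inr l) = δ' (.inr l)) → A δ = A δ')
    {H : ℝ≥0 × ℝ≥0 × ℝ≥0 → ENNReal} (hH : Measurable H) :
    ∫⁻ ω, A (fun m => Sum.elim Y D m ω) * H (D k ω, Y (k + 1) ω, D (k + 1) ω) ∂μ =
      (∫⁻ ω, A (fun m => Sum.elim Y D m ω) ∂μ) * ∫⁻ c, H c ∂(FD.prod (FY.prod FD)) := by
  have hY := hYD.measurable_forward
  have hD := hYD.measurable_backward
  -- P holds the delays that enter the k-th sampling time, namely Y 0, …, Y k and D 0, …, D (k - 1);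
  -- C holds those of the current cycle.
  let P : Finset (ℕ ⊕ ℕ) := (Finset.range (k + 1)).disjSum (Finset.range k)
  let C : Finset (ℕ ⊕ ℕ) := {.inr k, .inl (k + 1), .inr (k + 1)}
  have hPC : Disjoint P C := by
    rw [Finset.disjoint_left]
    rintro (m | m) hm hc
    · simp [P, C] at hm hc; omega
    · simp [P, C] at hm hc; omega
  have hind := hYD.indep_delays.indepFun_finset P C hPC hYD.measurable_elim
  -- Coordinates outside P are filled with zeros, which A does not see by `hpast`.
  let E : (P → ℝ≥0) → ℕ ⊕ ℕ → ℝ≥0 := fun r m => if h : m ∈ P then r ⟨m, h⟩ else 0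
  have hE : Measurable E := by
    refine measurable_pi_lambda _ fun m => ?_
    by_cases h : m ∈ P
    · simpa [E, h] using measurable_pi_apply _
    · simp [E, h]
  have hG : Measurable fun r : C → ℝ≥0 => (r ⟨.inr k, by simp [C]⟩,
      r ⟨.inl (k + 1), by simp [C]⟩, r ⟨.inr (k + 1), by simp [C]⟩) := by
    fun_prop
  have h := hind.comp (hA.comp hE) (hH.comp hG)
  have hAE : ∀ ω, A (E fun m : P => Sum.elim Y D m ω) = A fun m => Sum.elim Y D m ω := by
    intro ω
    refine hpast _ _ (fun l hl => ?_) fun l hl => ?_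
    · have : Sum.inl l ∈ P := by simp [P]; omega
      simp [E, this]
    · have : Sum.inr l ∈ P := by simp [P]; omega
      simp [E, this]
  have hAm : Measurable fun ω => A fun m => Sum.elim Y D m ω :=
    hA.comp (measurable_pi_lambda _ hYD.measurable_elim)
  have hHm : Measurable fun ω => H (D k ω, Y (k + 1) ω, D (k + 1) ω) :=
    hH.comp ((hD k).prodMk ((hY _).prodMk (hD _)))
  have h' : IndepFun (fun ω => A fun m => Sum.elim Y D m ω)
      (fun ω => H (D k ω, Y (k + 1) ω, D (k + 1) ω)) μ := by
    have e1 : (A ∘ E) ∘ (fun ω (m : P) => Sum.elim Y D m ω) =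
        fun ω => A fun m => Sum.elim Y D m ω := funext hAE
    rw [e1] at h
    exact h
  rw [← hYD.map_cycle k, lintegral_map hH ((hD k).prodMk ((hY _).prodMk (hD _)))]
  exact lintegral_mul_eq_lintegral_mul_lintegral_of_indepFun hAm hHm h'

variable [Fintype S] [DecidableEq S] [DiscreteMeasurableSpace S]
  {Q : Matrix S S ℝ} {W : S → ℝ≥0 → ℝ≥0} {t₀ : ℝ≥0}

omit [IsProbabilityMeasure μ] [DiscreteMeasurableSpace S] in
/-- A process with right-continuous paths through which a Markov chain factors is a Markov
chain for the image measure. -/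
theorem IsCTMC.map [MeasurableSingletonClass S] (hX : IsCTMC Q X μ)
    {Ω' : Type*} [MeasurableSpace Ω'] {π : Ω → Ω'}
    (hπ : Measurable π) {X' : ℝ≥0 → Ω' → S} (hm : ∀ t, Measurable (X' t))
    (hr : ∀ ω t, ∀ᶠ s in 𝓝[>] t, X' s ω = X' t ω) (hXπ : ∀ t ω, X' t (π ω) = X t ω) :
    IsCTMC Q X' (μ.map π) where
  measurable := hm
  right_continuous := hr
  markov n t ht x := by
    have hset : ∀ n : ℕ, MeasurableSet {ω | ∀ k ≤ n, X' (t k) ω = x k} := by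
      intro n
      simp only [Set.ofPred_forall]
      exact MeasurableSet.iInter fun k => MeasurableSet.iInter fun _ =>
        hm _ (measurableSet_singleton _)
    have hp : ∀ n : ℕ, π ⁻¹' {ω | ∀ k ≤ n, X' (t k) ω = x k}
        = {ω | ∀ k ≤ n, X (t k) ω = x k} := by
      intro n
      ext ω
      simp [hXπ]
    rw [measureReal_def, measureReal_def, Measure.map_apply hπ (hset _),
      Measure.map_apply hπ (hset _), hp, hp]
    exact hX.markov n t ht x

/-- The event that query `k` reaches the source by time `T` and finds it in state `i`. -/
def sampleEvent (X : ℝ≥0 → Ω → S) (Y D : ℕ → Ω → ℝ≥0) (W : S → ℝ≥0 → ℝ≥0) (t₀ : ℝ≥0)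
    (T : ℝ≥0) (k : ℕ) (i : S) : Set Ω :=
  {ω | sampleTime X Y D W t₀ k ω ≤ T ∧ X (sampleTime X Y D W t₀ k ω) ω = i}

omit [Fintype S] [DecidableEq S] in
theorem measurableSet_sampleEvent [Fintype S] (hX : Measurable fun p : ℝ≥0 × Ω => X p.1 p.2)
    (hY : ∀ k, Measurable (Y k)) (hD : ∀ k, Measurable (D k)) (hW : ∀ i, Measurable (W i))
    (T : ℝ≥0) (k : ℕ) (i : S) : MeasurableSet (sampleEvent X Y D W t₀ T k i) :=
  (measurableSet_le (measurable_sampleTime hX hY hD hW k) measurable_const).inter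
    (measurable_sampledState hX hY hD hW k (measurableSet_singleton i))

omit [MeasurableSpace S] [DiscreteMeasurableSpace S] in
theorem measurable_transitionMatrix_comp {α : Type*} [MeasurableSpace α] (Q : Matrix S S ℝ)
    {ρ : α → ℝ≥0} (hρ : Measurable ρ) (i j : S) :
    Measurable fun c => ENNReal.ofReal (transitionMatrix Q (ρ c) i j) :=
  ((continuous_transitionMatrix Q i j).measurable.comp
    (NNReal.continuous_coe.measurable.comp hρ)).ennreal_ofReal

/-- By independence the joint law of path and delays is a product, so the delays can be frozen by
Fubini. The Markov property then yields the transition factor, and what remains is a function of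
past delays times a function of the current cycle. The factor space is kept general because the
sampled state must be jointly measurable on it, which needs right-continuous paths at every point.
-/
theorem lintegral_cycle_of_factor (hX : IsCTMC Q X μ) (hYD : IsDelaySequence X Y D FY FD μ)
    (hW : ∀ i, Measurable (W i)) {Ω' : Type*} [MeasurableSpace Ω'] {π : Ω → Ω'}
    (hπ : Measurable π) {X' : ℝ≥0 → Ω' → S} (hm : ∀ t, Measurable (X' t))
    (hr : ∀ ω t, ∀ᶠ s in 𝓝[>] t, X' s ω = X' t ω) (hXπ : ∀ t ω, X' t (π ω) = X t ω)
    (hind : IndepFun π (fun ω (m : ℕ ⊕ ℕ) => Sum.elim Y D m ω) μ)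
    (T : ℝ≥0) (k : ℕ) (i j : S) {φ : ℝ≥0 × ℝ≥0 × ℝ≥0 → ENNReal} (hφ : Measurable φ)
    {ρ : ℝ≥0 × ℝ≥0 × ℝ≥0 → ℝ≥0} (hρ : Measurable ρ) :
    ∫⁻ ω in (sampleEvent X Y D W t₀ T k i ∩ {ω | X (sampleTime X Y D W t₀ k ω +
        ρ (D k ω, Y (k + 1) ω, D (k + 1) ω)) ω = j}), φ (D k ω, Y (k + 1) ω, D (k + 1) ω) ∂μ =
      μ (sampleEvent X Y D W t₀ T k i) *
        ∫⁻ c, φ c * ENNReal.ofReal (transitionMatrix Q (ρ c) i j) ∂(FD.prod (FY.prod FD)) := by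
  have hX' := hX.map hπ hm hr hXπ
  have hδ : Measurable fun ω (m : ℕ ⊕ ℕ) => Sum.elim Y D m ω :=
    measurable_pi_lambda _ hYD.measurable_elim
  set δ : Ω → ℕ ⊕ ℕ → ℝ≥0 := fun ω m => Sum.elim Y D m ω with hδdef
  have hprob : IsProbabilityMeasure (μ.map π) := Measure.isProbabilityMeasure_map hπ.aemeasurable
  have hprob' : IsProbabilityMeasure (μ.map δ) := Measure.isProbabilityMeasure_map hδ.aemeasurable
  have hjoint : μ.map (fun ω => (π ω, δ ω)) = (μ.map π).prod (μ.map δ) :=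
    (indepFun_iff_map_prod_eq_prod_map_map hπ.aemeasurable hδ.aemeasurable).1 hind
  -- the objects on the product space
  let XP : ℝ≥0 → Ω' × (ℕ ⊕ ℕ → ℝ≥0) → S := fun t p => X' t p.1
  let YP : ℕ → Ω' × (ℕ ⊕ ℕ → ℝ≥0) → ℝ≥0 := fun k p => p.2 (.inl k)
  let DP : ℕ → Ω' × (ℕ ⊕ ℕ → ℝ≥0) → ℝ≥0 := fun k p => p.2 (.inr k)
  let C : (ℕ ⊕ ℕ → ℝ≥0) → ℝ≥0 × ℝ≥0 × ℝ≥0 := fun δ =>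
    (δ (.inr k), δ (.inl (k + 1)), δ (.inr (k + 1)))
  have hC : Measurable C := by fun_prop
  have hXm := measurable_uncurry_of_rightContinuous hm hr
  have hXP : Measurable fun p : ℝ≥0 × Ω' × (ℕ ⊕ ℕ → ℝ≥0) => XP p.1 p.2 :=
    hXm.comp (measurable_fst.prodMk (measurable_fst.comp measurable_snd))
  have hYP : ∀ k, Measurable (YP k) := fun k => (measurable_pi_apply _).comp measurable_snd
  have hDP : ∀ k, Measurable (DP k) := fun k => (measurable_pi_apply _).comp measurable_snd
  have hEP := measurableSet_sampleEvent (t₀ := t₀) hXP hYP hDP hW T k i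
  have hFP : MeasurableSet {p : Ω' × (ℕ ⊕ ℕ → ℝ≥0) |
      XP (sampleTime XP YP DP W t₀ k p + ρ (C p.2)) p = j} :=
    (hXP.comp (((measurable_sampleTime hXP hYP hDP hW k).add
      (hρ.comp (hC.comp measurable_snd))).prodMk measurable_id)) (measurableSet_singleton j)
  have hS : ∀ ω, sampleTime X Y D W t₀ k ω = sampleTime XP YP DP W t₀ k (π ω, δ ω) := fun ω =>
    sampleTime_congr (X' := XP) (Y' := YP) (D' := DP) (ω' := (π ω, δ ω))
      (fun t => (hXπ t ω).symm) k (fun _ _ => rfl) (fun _ _ => rfl)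
  have hpre : sampleEvent X Y D W t₀ T k i =
      (fun ω => (π ω, δ ω)) ⁻¹' sampleEvent XP YP DP W t₀ T k i := by
    ext ω
    simp only [sampleEvent, Set.mem_preimage, Set.mem_ofPred_eq, hS, XP, hXπ]
  have hpre' : {ω | X (sampleTime X Y D W t₀ k ω + ρ (D k ω, Y (k + 1) ω, D (k + 1) ω)) ω = j} =
      (fun ω => (π ω, δ ω)) ⁻¹'
        {p | XP (sampleTime XP YP DP W t₀ k p + ρ (C p.2)) p = j} := by
    ext ω
    simp only [Set.mem_preimage, Set.mem_ofPred_eq, hS, XP, hXπ]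
    rfl
  have hpair : Measurable fun ω => (π ω, δ ω) := hπ.prodMk hδ
  -- the past factor
  let A : (ℕ ⊕ ℕ → ℝ≥0) → ENNReal := fun δ =>
    μ.map π {ω | sampleTime X' (fun n _ => δ (.inl n)) (fun n _ => δ (.inr n)) W t₀ k ω ≤ T ∧
      X' (sampleTime X' (fun n _ => δ (.inl n)) (fun n _ => δ (.inr n)) W t₀ k ω) ω = i}
  have hSP : ∀ ω δ, sampleTime XP YP DP W t₀ k (ω, δ) =
      sampleTime X' (fun n _ => δ (.inl n)) (fun n _ => δ (.inr n)) W t₀ k ω := fun ω δ =>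
    sampleTime_congr (X := XP) (Y := YP) (D := DP) (ω := (ω, δ)) (X' := X')
      (Y' := fun n _ => δ (.inl n)) (D' := fun n _ => δ (.inr n)) (ω' := ω) (fun t => rfl) k
      (fun _ _ => rfl) (fun _ _ => rfl)
  have hAeq : ∀ δ, A δ = μ.map π ((fun ω => (ω, δ)) ⁻¹' sampleEvent XP YP DP W t₀ T k i) := by
    intro δ
    simp only [A, sampleEvent, Set.preimage_ofPred_eq, hSP, XP]
  have hA : Measurable A := by
    have := measurable_measure_prodMk_right (μ := μ.map π) hEP
    simpa only [← hAeq] using this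
  have hpast : ∀ δ δ' : ℕ ⊕ ℕ → ℝ≥0, (∀ l ≤ k, δ (.inl l) = δ' (.inl l)) →
      (∀ l < k, δ (.inr l) = δ' (.inr l)) → A δ = A δ' := by
    intro δ δ' h1 h2
    have : ∀ ω, sampleTime X' (fun n _ => δ (.inl n)) (fun n _ => δ (.inr n)) W t₀ k ω =
        sampleTime X' (fun n _ => δ' (.inl n)) (fun n _ => δ' (.inr n)) W t₀ k ω := fun ω =>
      sampleTime_congr (fun t => rfl) k h1 h2
    simp only [A, this]
  have hintA : ∫⁻ ω, A (δ ω) ∂μ = μ (sampleEvent X Y D W t₀ T k i) := by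
    rw [hpre, ← Measure.map_apply hpair hEP, hjoint, Measure.prod_apply_symm hEP,
      lintegral_map (measurable_measure_prodMk_right hEP) hδ]
    simp only [hAeq]
  have hH : Measurable fun c => φ c * ENNReal.ofReal (transitionMatrix Q (ρ c) i j) :=
    hφ.mul (measurable_transitionMatrix_comp Q hρ i j)
  have hGm : Measurable fun p : Ω' × (ℕ ⊕ ℕ → ℝ≥0) => φ (C p.2) :=
    hφ.comp (hC.comp measurable_snd)
  have hSet := hEP.inter hFP
  calc _ = ∫⁻ p in (sampleEvent XP YP DP W t₀ T k i ∩
          {p | XP (sampleTime XP YP DP W t₀ k p + ρ (C p.2)) p = j}), φ (C p.2)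
          ∂((μ.map π).prod (μ.map δ)) := by
        rw [← hjoint, setLIntegral_map hSet hGm hpair, hpre, hpre', ← Set.preimage_inter]
        rfl
    _ = ∫⁻ δ', A δ' * (φ (C δ') * ENNReal.ofReal (transitionMatrix Q (ρ (C δ')) i j))
          ∂(μ.map δ) := by
        rw [← lintegral_indicator hSet, lintegral_prod_symm _
          (hGm.indicator hSet).aemeasurable]
        refine lintegral_congr fun δ' => ?_
        have e : ∀ ω, ((sampleEvent XP YP DP W t₀ T k i ∩
            {p | XP (sampleTime XP YP DP W t₀ k p + ρ (C p.2)) p = j}).indicator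
            (fun p => φ (C p.2)) (ω, δ')) =
            ((fun ω => (ω, δ')) ⁻¹' (sampleEvent XP YP DP W t₀ T k i ∩
            {p | XP (sampleTime XP YP DP W t₀ k p + ρ (C p.2)) p = j})).indicator
            (fun _ => φ (C δ')) ω := fun ω => rfl
        simp_rw [e]
        rw [lintegral_indicator_const (measurable_prodMk_right hSet)]
        have e2 : ((fun ω => (ω, δ')) ⁻¹' (sampleEvent XP YP DP W t₀ T k i ∩
            {p | XP (sampleTime XP YP DP W t₀ k p + ρ (C p.2)) p = j})) =
            {ω | (sampleTime X' (fun n _ => δ' (.inl n)) (fun n _ => δ' (.inr n)) W t₀ k ω ≤ T ∧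
              X' (sampleTime X' (fun n _ => δ' (.inl n)) (fun n _ => δ' (.inr n)) W t₀ k ω) ω
                = i) ∧
              X' (sampleTime X' (fun n _ => δ' (.inl n)) (fun n _ => δ' (.inr n)) W t₀ k ω
                + ρ (C δ')) ω = j} := by
          ext ω
          simp only [sampleEvent, Set.mem_preimage, Set.mem_inter_iff, Set.mem_ofPred_eq, hSP, XP]
        -- For frozen delays the slice is an event of the path alone and the lag is a fixed number.
        rw [e2, hX'.measure_sampleTime hW]
        simp only [A]
        ring
    _ = _ := by
        refine (lintegral_map (hA.mul (hH.comp hC)) hδ).trans ?_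
        rw [← hintA]
        exact hYD.lintegral_past_mul_cycle k hA hpast hH

/-- The cycle identity: given the state reported by reply `k`, the delays of the cycle and the
evolution of the source since the sampling time do not depend on the past. -/
theorem lintegral_cycle (hX : IsCTMC Q X μ) (hYD : IsDelaySequence X Y D FY FD μ)
    (hW : ∀ i, Measurable (W i)) (T : ℝ≥0) (k : ℕ) (i j : S)
    {φ : ℝ≥0 × ℝ≥0 × ℝ≥0 → ENNReal} (hφ : Measurable φ)
    {ρ : ℝ≥0 × ℝ≥0 × ℝ≥0 → ℝ≥0} (hρ : Measurable ρ) :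
    ∫⁻ ω in (sampleEvent X Y D W t₀ T k i ∩ {ω | X (sampleTime X Y D W t₀ k ω +
        ρ (D k ω, Y (k + 1) ω, D (k + 1) ω)) ω = j}), φ (D k ω, Y (k + 1) ω, D (k + 1) ω) ∂μ =
      μ (sampleEvent X Y D W t₀ T k i) *
        ∫⁻ c, φ c * ENNReal.ofReal (transitionMatrix Q (ρ c) i j) ∂(FD.prod (FY.prod FD)) := by
  let path : Ω → ℝ≥0 → S := fun ω t => X t ω
  have hpath : Measurable path := measurable_pi_lambda _ hX.measurable
  -- The factor space is the range of the path map: a general function is not right-continuous, but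
  -- every point of the range is a path of X. The range carries the trace of the product σ-algebra,
  -- so independence is inherited.
  refine lintegral_cycle_of_factor hX hYD hW (Ω' := Set.range path)
    (π := fun ω => ⟨path ω, ω, rfl⟩) (hpath.subtype_mk) (X' := fun t x => x.1 t)
    (fun t => (measurable_pi_apply t).comp measurable_subtype_coe) ?_ (fun _ _ => rfl) ?_
    T k i j hφ hρ
  · rintro ⟨_, ω, rfl⟩ t
    exact hX.right_continuous ω t
  · rw [IndepFun_iff_Indep]
    have h := hYD.indep_process
    rw [IndepFun_iff_Indep] at h
    convert h using 1
    exact MeasurableSpace.comap_comp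

end Cycle

/-! ### Mean transition, length and reward of a cycle -/

section CycleConsequences

variable {S : Type*} [Fintype S] [DecidableEq S] [MeasurableSpace S] [DiscreteMeasurableSpace S]
variable {Ω : Type*} [MeasurableSpace Ω] {μ : Measure Ω} [IsProbabilityMeasure μ]
  {X : ℝ≥0 → Ω → S} {Y D : ℕ → Ω → ℝ≥0} {FY FD : Measure ℝ≥0}
  {Q : Matrix S S ℝ} {W : S → ℝ≥0 → ℝ≥0} {t₀ : ℝ≥0}

/-- The probability that the process moves from `i` to `j` between consecutive sampling
times. -/
noncomputable def cycleTransition (Q : Matrix S S ℝ) (W : S → ℝ≥0 → ℝ≥0) (FY FD : Measure ℝ≥0)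
    (i j : S) : ENNReal :=
  ∫⁻ c, ENNReal.ofReal (transitionMatrix Q ((c.1 + W i c.1 + c.2.1 : ℝ≥0) : ℝ) i j)
    ∂(FD.prod (FY.prod FD))

/-- The mean length of a cycle in which state `i` was reported. -/
noncomputable def cycleLength (W : S → ℝ≥0 → ℝ≥0) (FY FD : Measure ℝ≥0) (i : S) : ENNReal :=
  ∫⁻ c, ((W i c.1 + (c.2.1 + c.2.2) : ℝ≥0) : ENNReal) ∂(FD.prod (FY.prod FD))

/-- The mean time during which the estimate is correct in a cycle in which state `i` was
reported. -/
noncomputable def cycleReward (Q : Matrix S S ℝ) (W : S → ℝ≥0 → ℝ≥0) (FY FD : Measure ℝ≥0)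
    (e : S → ℝ≥0 → S) (i : S) : ENNReal :=
  ∫⁻ c, (∫⁻ t in Set.Ico (c.1 : ℝ) ((c.1 + (W i c.1 + (c.2.1 + c.2.2)) : ℝ≥0) : ℝ),
    ENNReal.ofReal (transitionMatrix Q (t.toNNReal : ℝ) i (e i t.toNNReal)))
    ∂(FD.prod (FY.prod FD))

/-- The indicator of correctness of the estimate. -/
def correct (X Xhat : ℝ≥0 → Ω → S) (t : ℝ) (ω : Ω) : ENNReal :=
  if X t.toNNReal ω = Xhat t.toNNReal ω then 1 else 0

/-- This is the cycle identity with lag zero, where the transition matrix is the identity. -/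
theorem setLIntegral_sampleEvent_delays (hX : IsCTMC Q X μ)
    (hYD : IsDelaySequence X Y D FY FD μ) (hW : ∀ i, Measurable (W i)) (T : ℝ≥0) (k : ℕ) (i : S)
    {φ : ℝ≥0 × ℝ≥0 × ℝ≥0 → ENNReal} (hφ : Measurable φ) :
    ∫⁻ ω in sampleEvent X Y D W t₀ T k i, φ (D k ω, Y (k + 1) ω, D (k + 1) ω) ∂μ =
      μ (sampleEvent X Y D W t₀ T k i) * ∫⁻ c, φ c ∂(FD.prod (FY.prod FD)) := by
  have h := lintegral_cycle (t₀ := t₀) hX hYD hW T k i i hφ (ρ := fun _ => 0) measurable_const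
  simp only [add_zero, NNReal.coe_zero, transitionMatrix_zero, Matrix.one_apply_eq,
    ENNReal.ofReal_one, mul_one] at h
  rwa [Set.inter_eq_left.2 fun ω hω => hω.2] at h

/-- Once the reported state is known to be i, the next sampling time is a lag away that depends only
on the delays of the cycle. -/
theorem measure_sampleEvent_inter_next (hX : IsCTMC Q X μ)
    (hYD : IsDelaySequence X Y D FY FD μ) (hW : ∀ i, Measurable (W i)) (T : ℝ≥0) (k : ℕ)
    (i j : S) :
    μ (sampleEvent X Y D W t₀ T k i ∩
        {ω | X (sampleTime X Y D W t₀ (k + 1) ω) ω = j}) =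
      μ (sampleEvent X Y D W t₀ T k i) * cycleTransition Q W FY FD i j := by
  have hρ : Measurable fun c : ℝ≥0 × ℝ≥0 × ℝ≥0 => c.1 + W i c.1 + c.2.1 :=
    (measurable_fst.add ((hW i).comp measurable_fst)).add (measurable_fst.comp measurable_snd)
  have h := lintegral_cycle (t₀ := t₀) hX hYD hW T k i j (φ := fun _ => 1) measurable_const hρ
  simp only [lintegral_const, one_mul, Measure.restrict_apply_univ] at h
  rw [cycleTransition, ← h]
  congr 1
  ext ω
  refine and_congr_right fun hω => ?_
  simp only [Set.mem_ofPred_eq, sampleTime_succ, hω.2]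

omit [Fintype S] [MeasurableSpace S] [DiscreteMeasurableSpace S] [MeasurableSpace Ω] in
theorem correct_translate {e₀ : ℝ≥0 → S} {e : S → ℝ≥0 → S} {k : ℕ} {ω : Ω} {u : ℝ}
    (hu : D k ω ≤ u) (hu' : u < D k ω + (W (X (sampleTime X Y D W t₀ k ω) ω) (D k ω) +
      (Y (k + 1) ω + D (k + 1) ω))) :
    correct X (estimate X Y D W t₀ e₀ e) (sampleTime X Y D W t₀ k ω + u) ω =
      if X (sampleTime X Y D W t₀ k ω + u.toNNReal) ω =
        e (X (sampleTime X Y D W t₀ k ω) ω) u.toNNReal then 1 else 0 := by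
  have hu0 : 0 ≤ u := (NNReal.coe_nonneg _).trans hu
  lift u to ℝ≥0 using hu0
  have h1 : D k ω ≤ u := by exact_mod_cast hu
  have h2 : u < D k ω + (W (X (sampleTime X Y D W t₀ k ω) ω) (D k ω) +
      (Y (k + 1) ω + D (k + 1) ω)) := by exact_mod_cast hu'
  rw [correct, ← NNReal.coe_add, Real.toNNReal_coe, Real.toNNReal_coe]
  have hR : replyTime X Y D W t₀ k ω ≤ sampleTime X Y D W t₀ k ω + u := by
    rw [replyTime]; gcongr
  have hR' : sampleTime X Y D W t₀ k ω + u < replyTime X Y D W t₀ (k + 1) ω := by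
    rw [replyTime_succ, replyTime]
    rw [add_assoc, add_assoc (W _ _)]
    gcongr
  have hest : estimate X Y D W t₀ e₀ e (sampleTime X Y D W t₀ k ω + u) ω =
      e (X (sampleTime X Y D W t₀ k ω) ω) u := by
    rw [estimate, if_neg (not_lt.2 ((monotone_replyTime ω (Nat.zero_le k)).trans hR)),
      lastReply_eq hR hR', add_tsub_cancel_left]
  rw [hest]

omit [Fintype S] [MeasurableSpace S] [DiscreteMeasurableSpace S] [MeasurableSpace Ω] in
/-- The reward of a cycle, expressed in the age of the current sample. -/
theorem setLIntegral_correct_cycle {e₀ : ℝ≥0 → S} {e : S → ℝ≥0 → S} (k : ℕ) (ω : Ω) :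
    ∫⁻ t in Set.Ico (replyTime X Y D W t₀ k ω : ℝ) (replyTime X Y D W t₀ (k + 1) ω),
        correct X (estimate X Y D W t₀ e₀ e) t ω =
      ∫⁻ u in Set.Ico (D k ω : ℝ) ((D k ω + (W (X (sampleTime X Y D W t₀ k ω) ω) (D k ω) +
        (Y (k + 1) ω + D (k + 1) ω)) : ℝ≥0) : ℝ),
        if X (sampleTime X Y D W t₀ k ω + u.toNNReal) ω =
          e (X (sampleTime X Y D W t₀ k ω) ω) u.toNNReal then 1 else 0 := by
  rw [← lintegral_indicator measurableSet_Ico, ← lintegral_indicator measurableSet_Ico,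
    ← lintegral_add_left_eq_self _ (sampleTime X Y D W t₀ k ω : ℝ)]
  refine lintegral_congr fun u => ?_
  have hiff : ((sampleTime X Y D W t₀ k ω : ℝ) + u ∈
      Set.Ico (replyTime X Y D W t₀ k ω : ℝ) (replyTime X Y D W t₀ (k + 1) ω)) ↔
      u ∈ Set.Ico (D k ω : ℝ) ((D k ω + (W (X (sampleTime X Y D W t₀ k ω) ω) (D k ω) +
        (Y (k + 1) ω + D (k + 1) ω)) : ℝ≥0) : ℝ) := by
    rw [replyTime_succ, replyTime]
    push_cast
    rw [Set.mem_Ico, Set.mem_Ico]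
    constructor <;> rintro ⟨h1, h2⟩ <;> constructor <;> linarith
  by_cases h : u ∈ Set.Ico (D k ω : ℝ) ((D k ω + (W (X (sampleTime X Y D W t₀ k ω) ω) (D k ω) +
        (Y (k + 1) ω + D (k + 1) ω)) : ℝ≥0) : ℝ)
  · rw [Set.indicator_of_mem (hiff.2 h), Set.indicator_of_mem h]
    exact correct_translate h.1 (by simpa using h.2)
  · rw [Set.indicator_of_notMem (mt hiff.1 h), Set.indicator_of_notMem h]

/-- Expectation and integration over the age u are exchanged: for a fixed age both the lag and the
estimate `e i u` are deterministic, so the cycle identity applies for each u. A second exchange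
restores `cycleReward`. -/
theorem setLIntegral_sampleEvent_reward (hX : IsCTMC Q X μ) [SFinite FY] [SFinite FD]
    (hYD : IsDelaySequence X Y D FY FD μ) (hW : ∀ i, Measurable (W i)) {e₀ : ℝ≥0 → S}
    {e : S → ℝ≥0 → S} (he : ∀ i, Measurable (e i)) (T : ℝ≥0) (k : ℕ) (i : S) :
    ∫⁻ ω in sampleEvent X Y D W t₀ T k i,
        (∫⁻ t in Set.Ico (replyTime X Y D W t₀ k ω : ℝ) (replyTime X Y D W t₀ (k + 1) ω),
          correct X (estimate X Y D W t₀ e₀ e) t ω) ∂μ =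
      μ (sampleEvent X Y D W t₀ T k i) * cycleReward Q W FY FD e i := by
  have hXm := measurable_uncurry_of_rightContinuous hX.measurable hX.right_continuous
  have hY := hYD.measurable_forward
  have hD := hYD.measurable_backward
  have hSm := measurable_sampleTime (t₀ := t₀) hXm hY hD hW k
  have hE := measurableSet_sampleEvent (t₀ := t₀) hXm hY hD hW T k i
  have hcm : Measurable fun ω => (D k ω, Y (k + 1) ω, D (k + 1) ω) :=
    (hD k).prodMk ((hY _).prodMk (hD _))
  let L : Set (ℝ × ℝ≥0 × ℝ≥0 × ℝ≥0) := {q | (q.2.1 : ℝ) ≤ q.1 ∧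
    q.1 < ((q.2.1 + (W i q.2.1 + (q.2.2.1 + q.2.2.2)) : ℝ≥0) : ℝ)}
  have hL : MeasurableSet L := by
    have h1 : Measurable fun q : ℝ × ℝ≥0 × ℝ≥0 × ℝ≥0 => q.2.1 := by fun_prop
    have h2 : Measurable fun q : ℝ × ℝ≥0 × ℝ≥0 × ℝ≥0 =>
        q.2.1 + (W i q.2.1 + (q.2.2.1 + q.2.2.2)) :=
      h1.add (((hW i).comp h1).add (by fun_prop))
    exact (measurableSet_le (NNReal.continuous_coe.measurable.comp h1) measurable_fst).inter
      (measurableSet_lt measurable_fst (NNReal.continuous_coe.measurable.comp h2))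
  -- φ u c indicates that age u occurs between the two replies of a cycle with delays c.
  let φ : ℝ → ℝ≥0 × ℝ≥0 × ℝ≥0 → ENNReal := fun u c => L.indicator 1 (u, c)
  have hφ' : Measurable fun q : ℝ × ℝ≥0 × ℝ≥0 × ℝ≥0 => φ q.1 q.2 :=
    measurable_one.indicator hL
  have hφ : ∀ u, Measurable (φ u) := fun u => hφ'.comp (measurable_const.prodMk measurable_id)
  let M : Set (Ω × ℝ) := {q | X (sampleTime X Y D W t₀ k q.1 + q.2.toNNReal) q.1 =
    e i q.2.toNNReal}
  have hM : MeasurableSet M :=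
    measurableSet_eq_fun
      (hXm.comp (((hSm.comp measurable_fst).add
        (measurable_real_toNNReal.comp measurable_snd)).prodMk measurable_fst))
      ((he i).comp (measurable_real_toNNReal.comp measurable_snd))
  calc _ = ∫⁻ ω in sampleEvent X Y D W t₀ T k i, (∫⁻ u,
          φ u (D k ω, Y (k + 1) ω, D (k + 1) ω) * M.indicator 1 (ω, u)) ∂μ := by
        refine setLIntegral_congr_fun hE fun ω hω => ?_
        simp only [setLIntegral_correct_cycle]
        rw [← lintegral_indicator measurableSet_Ico]
        refine lintegral_congr fun u => ?_
        simp only [φ, L, M, Set.indicator_apply, Set.mem_Ico, Set.mem_ofPred_eq, hω.2,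
          Pi.one_apply, ite_mul, one_mul, zero_mul]
    _ = ∫⁻ u, ∫⁻ ω in sampleEvent X Y D W t₀ T k i,
          φ u (D k ω, Y (k + 1) ω, D (k + 1) ω) * M.indicator 1 (ω, u) ∂μ := by
        refine lintegral_lintegral_swap (Measurable.aemeasurable ?_)
        exact (hφ'.comp (measurable_snd.prodMk (hcm.comp measurable_fst))).mul
          (measurable_one.indicator hM)
    _ = ∫⁻ u, μ (sampleEvent X Y D W t₀ T k i) * ∫⁻ c, φ u c * ENNReal.ofReal
          (transitionMatrix Q (u.toNNReal : ℝ) i (e i u.toNNReal)) ∂(FD.prod (FY.prod FD)) := by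
        refine lintegral_congr fun u => ?_
        rw [← lintegral_cycle (t₀ := t₀) hX hYD hW T k i (e i u.toNNReal) (hφ u)
          (ρ := fun _ => u.toNNReal) measurable_const]
        have hMu : MeasurableSet {ω | X (sampleTime X Y D W t₀ k ω + u.toNNReal) ω =
            e i u.toNNReal} := measurable_prodMk_right (y := u) hM
        rw [Set.inter_comm, ← Measure.restrict_restrict hMu, ← lintegral_indicator hMu]
        refine lintegral_congr fun ω => ?_
        simp only [M, Set.indicator_apply, Set.mem_ofPred_eq, Pi.one_apply, mul_ite, mul_one,
          mul_zero]
    _ = _ := by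
        have hPm : Measurable fun u : ℝ => ENNReal.ofReal
            (transitionMatrix Q (u.toNNReal : ℝ) i (e i u.toNNReal)) := by
          have h1 : Measurable fun q : S × ℝ =>
              ENNReal.ofReal (transitionMatrix Q (q.2.toNNReal : ℝ) i q.1) :=
            measurable_from_prod_countable_right fun j =>
              measurable_transitionMatrix_comp Q measurable_real_toNNReal i j
          exact h1.comp (((he i).comp measurable_real_toNNReal).prodMk measurable_id)
        rw [lintegral_const_mul', cycleReward]
        · congr 1
          rw [lintegral_lintegral_swap]
          · refine lintegral_congr fun c => ?_
            rw [← lintegral_indicator measurableSet_Ico]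
            refine lintegral_congr fun u => ?_
            simp only [φ, L, Set.indicator_apply, Set.mem_Ico, Set.mem_ofPred_eq, Pi.one_apply,
              ite_mul, one_mul, zero_mul]
          · exact (hφ'.mul (hPm.comp measurable_fst)).aemeasurable
        · exact measure_ne_top _ _

end CycleConsequences

/-! ### Pathwise comparison of cycles with the time horizon -/

section Pathwise

/-- The increments of a sequence up to its first passage above `T`, truncated at one. -/
theorem sum_min_increment_le {s τ : ℕ → ℝ≥0} (hs : ∀ k, s (k + 1) = s k + τ k) (T : ℝ≥0) (n : ℕ) :
    ∑ k ∈ Finset.range n, (if s k ≤ T then min (τ k) 1 else 0) ≤ T + 1 := by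
  -- The bound by s n is carried along: if s n ≤ T, the sum before step n is at most T, and the
  -- truncated step adds at most one.
  have h : ∑ k ∈ Finset.range n, (if s k ≤ T then min (τ k) 1 else 0) ≤ min (s n) (T + 1) := by
    induction n with
    | zero => simp
    | succ n ih =>
      rw [Finset.sum_range_succ]
      split_ifs with hn
      · refine le_min ?_ ?_
        · rw [hs]
          exact add_le_add (ih.trans (min_le_left _ _)) (min_le_left _ _)
        · exact add_le_add ((ih.trans (min_le_left _ _)).trans hn) (min_le_right _ _)
      · rw [add_zero]
        exact ih.trans (min_le_min_right _ (by rw [hs]; exact le_self_add))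
  exact h.trans (min_le_right _ _)

theorem setLIntegral_Ico_le {J : ℝ → ENNReal} (hJ : ∀ t, J t ≤ 1) (a b : ℝ≥0) :
    ∫⁻ t in Set.Ico (a : ℝ) b, J t ≤ ((b - a : ℝ≥0) : ENNReal) := by
  calc _ ≤ ∫⁻ _ in Set.Ico (a : ℝ) b, (1 : ENNReal) := lintegral_mono fun t => hJ t
    _ = ENNReal.ofReal ((b : ℝ) - a) := by simp
    _ = _ := by
      rw [ENNReal.ofReal, NNReal.sub_def]

theorem setLIntegral_Ico_add_Ico (J : ℝ → ENNReal) {a b c : ℝ≥0} (hab : a ≤ b) (hbc : b ≤ c) :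
    (∫⁻ t in Set.Ico (a : ℝ) b, J t) + ∫⁻ t in Set.Ico (b : ℝ) c, J t =
      ∫⁻ t in Set.Ico (a : ℝ) c, J t := by
  rw [← Set.Ico_union_Ico_eq_Ico (NNReal.coe_le_coe.2 hab) (NNReal.coe_le_coe.2 hbc),
    lintegral_union measurableSet_Ico (Set.Ico_disjoint_Ico_same)]

theorem sum_setLIntegral_Ico (J : ℝ → ENNReal) {r : ℕ → ℝ≥0} (hr : Monotone r) (n : ℕ) :
    ∑ k ∈ Finset.range n, ∫⁻ t in Set.Ico (r k : ℝ) (r (k + 1)), J t =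
      ∫⁻ t in Set.Ico (r 0 : ℝ) (r n), J t := by
  induction n with
  | zero => simp
  | succ n ih =>
    rw [Finset.sum_range_succ, ih, setLIntegral_Ico_add_Ico J (hr n.zero_le) (hr n.le_succ)]

variable {s r u : ℕ → ℝ≥0} {J : ℝ → ENNReal}

/-- The rewards of the cycles whose sampling time is at most `T` exceed the reward up to time `T`
by at most the overshoot. -/
theorem sum_cycle_le (hs : Monotone s) (hr : Monotone r) (hu : ∀ k, r (k + 1) ≤ s k + u k)
    (hJ : ∀ t, J t ≤ 1) (T b : ℝ≥0) (n : ℕ) :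
    ∑ k ∈ Finset.range n,
        (if s k ≤ T then ∫⁻ t in Set.Ico (r k : ℝ) (r (k + 1)), J t else 0) ≤
      (∫⁻ t in Set.Ico (0 : ℝ) T, J t) + b +
        ∑ k ∈ Finset.range n, (if s k ≤ T then ((u k - b : ℝ≥0) : ENNReal) else 0) := by
  induction n with
  | zero => simp
  | succ n ih =>
    by_cases hn : s n ≤ T
    -- If s n ≤ T, all earlier cycles count too and their integrals merge into one. Its part beyond
    -- T has length at most u n ≤ b + (u n - b), so only the last overshoot is paid for.
    · have hall : ∀ k ∈ Finset.range (n + 1), s k ≤ T := fun k hk =>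
        (hs (Nat.le_of_lt_succ (Finset.mem_range.1 hk))).trans hn
      rw [Finset.sum_congr rfl fun k hk => if_pos (hall k hk), sum_setLIntegral_Ico J hr,
        Finset.sum_range_succ, if_pos hn]
      have h1 : ∫⁻ t in Set.Ico (r 0 : ℝ) (r (n + 1)), J t ≤
          (∫⁻ t in Set.Ico (0 : ℝ) T, J t) + ∫⁻ t in Set.Ico (T : ℝ) (r (n + 1)), J t := by
        refine (lintegral_mono_set ?_).trans (lintegral_union_le _ _ _)
        rintro t ⟨h1, h2⟩
        rcases lt_or_ge t T with h | h
        · exact Or.inl ⟨(r 0).2.trans h1, h⟩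
        · exact Or.inr ⟨h, h2⟩
      have h2 : ∫⁻ t in Set.Ico (T : ℝ) (r (n + 1)), J t ≤ b + ((u n - b : ℝ≥0) : ENNReal) := by
        refine (setLIntegral_Ico_le hJ _ _).trans ?_
        rw [← ENNReal.coe_add, ENNReal.coe_le_coe]
        refine le_trans ?_ le_add_tsub
        rw [tsub_le_iff_left]
        exact (hu n).trans (by gcongr)
      refine h1.trans ?_
      rw [add_assoc]
      refine add_le_add le_rfl (h2.trans (add_le_add le_rfl ?_))
      exact le_add_self
    · rw [Finset.sum_range_succ, Finset.sum_range_succ, if_neg hn, if_neg hn, add_zero, add_zero]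
      exact ih

/-- The reward up to time `T` is covered by the cycles whose sampling time is at most `T`. -/
theorem setLIntegral_le_tsum_cycle (hsr : ∀ k, s k ≤ r k) (hJ : ∀ t, J t ≤ 1) {T : ℝ≥0}
    (hT : ∃ n, T < s n) :
    ∫⁻ t in Set.Ico (0 : ℝ) T, J t ≤ r 0 +
      ∑' k, (if s k ≤ T then ∫⁻ t in Set.Ico (r k : ℝ) (r (k + 1)), J t else 0) := by
  have hsub : Set.Ico (0 : ℝ) T ⊆ Set.Ico (0 : ℝ) (r 0) ∪
      ⋃ k, (if s k ≤ T then Set.Ico (r k : ℝ) (r (k + 1)) else ∅) := by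
    rintro t ⟨h0, h1⟩
    lift t to ℝ≥0 using h0
    have h1' : t < T := by exact_mod_cast h1
    have hex : ∃ n, t < r n := by
      obtain ⟨n, hn⟩ := hT
      exact ⟨n, h1'.trans (hn.trans_le (hsr n))⟩
    classical
    -- The first reply after t decides: index 0 means t precedes all replies, and index k + 1 puts t
    -- in cycle k, where s k ≤ r k ≤ t < T.
    rcases hfind : Nat.find hex with _ | k
    · have h := Nat.find_spec hex
      rw [hfind] at h
      exact Or.inl ⟨t.2, by exact_mod_cast h⟩
    · have h := Nat.find_spec hex
      rw [hfind] at h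
      have hk : r k ≤ t := not_lt.1 (Nat.find_min hex (m := k) (by omega))
      refine Or.inr (Set.mem_iUnion.2 ⟨k, ?_⟩)
      rw [if_pos ((hsr k).trans (hk.trans h1'.le))]
      exact ⟨by exact_mod_cast hk, by exact_mod_cast h⟩
  refine (lintegral_mono_set hsub).trans ((lintegral_union_le _ _ _).trans (add_le_add ?_ ?_))
  · have := setLIntegral_Ico_le hJ 0 (r 0)
    simpa using this
  · refine (lintegral_iUnion_le _ _).trans (ENNReal.tsum_le_tsum fun k => ?_)
    split_ifs <;> simp

end Pathwise

/-! ### Expected totals over cycles as sums over visits -/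

section Visits

variable {S : Type*} [MeasurableSpace S]
variable {Ω : Type*} [MeasurableSpace Ω] {μ : Measure Ω}
  {X : ℝ≥0 → Ω → S} {Y D : ℕ → Ω → ℝ≥0} {W : S → ℝ≥0 → ℝ≥0} {t₀ : ℝ≥0}

/-- The expected number of queries that reach the source by time `T` and find it in state `i`. -/
noncomputable def visits (X : ℝ≥0 → Ω → S) (Y D : ℕ → Ω → ℝ≥0) (W : S → ℝ≥0 → ℝ≥0) (t₀ : ℝ≥0)
    (μ : Measure Ω) (T : ℝ≥0) (i : S) : ENNReal :=
  ∑' k, μ (sampleEvent X Y D W t₀ T k i)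

variable [Fintype S] [DiscreteMeasurableSpace S]

theorem setLIntegral_sampleTime_le (hX : Measurable fun p : ℝ≥0 × Ω => X p.1 p.2)
    (hY : ∀ k, Measurable (Y k)) (hD : ∀ k, Measurable (D k)) (hW : ∀ i, Measurable (W i))
    (T : ℝ≥0) (k : ℕ) (f : Ω → ENNReal) :
    ∫⁻ ω in {ω | sampleTime X Y D W t₀ k ω ≤ T}, f ω ∂μ =
      ∑ i, ∫⁻ ω in sampleEvent X Y D W t₀ T k i, f ω ∂μ := by
  have hU : {ω | sampleTime X Y D W t₀ k ω ≤ T} =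
      ⋃ i ∈ (Finset.univ : Finset S), sampleEvent X Y D W t₀ T k i := by
    ext ω
    simp [sampleEvent]
  rw [hU, lintegral_biUnion_finset]
  · intro i _ j _ hij
    refine Set.disjoint_left.2 fun ω hi hj => hij ?_
    rw [← hi.2, hj.2]
  · exact fun i _ => measurableSet_sampleEvent hX hY hD hW T k i

/-- A Wald identity: the factor H i does not depend on k, so summation over k only collects the
probabilities that make up `visits`. -/
theorem lintegral_tsum_sampleTime_le (hX : Measurable fun p : ℝ≥0 × Ω => X p.1 p.2)
    (hY : ∀ k, Measurable (Y k)) (hD : ∀ k, Measurable (D k)) (hW : ∀ i, Measurable (W i))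
    (T : ℝ≥0) {f : ℕ → Ω → ENNReal} (hf : ∀ k, Measurable (f k)) {H : S → ENNReal}
    (hH : ∀ k i, ∫⁻ ω in sampleEvent X Y D W t₀ T k i, f k ω ∂μ =
      μ (sampleEvent X Y D W t₀ T k i) * H i) :
    ∫⁻ ω, ∑' k, (if sampleTime X Y D W t₀ k ω ≤ T then f k ω else 0) ∂μ =
      ∑ i, visits X Y D W t₀ μ T i * H i := by
  have hset : ∀ k, MeasurableSet {ω | sampleTime X Y D W t₀ k ω ≤ T} := fun k =>
    measurableSet_le (measurable_sampleTime hX hY hD hW k) measurable_const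
  rw [lintegral_tsum fun k => ((hf k).ite (hset k) measurable_const).aemeasurable]
  have h1 : ∀ k, ∫⁻ ω, (if sampleTime X Y D W t₀ k ω ≤ T then f k ω else 0) ∂μ =
      ∑ i, μ (sampleEvent X Y D W t₀ T k i) * H i := by
    intro k
    simp_rw [← hH]
    rw [← setLIntegral_sampleTime_le hX hY hD hW, ← lintegral_indicator (hset k)]
    rfl
  simp_rw [h1, visits, ← ENNReal.tsum_mul_right]
  rw [Summable.tsum_finsetSum fun _ _ => ENNReal.summable]

theorem measurable_setLIntegral_Ico {J : ℝ → Ω → ENNReal}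
    (hJ : Measurable fun p : ℝ × Ω => J p.1 p.2) {a b : Ω → ℝ≥0} (ha : Measurable a)
    (hb : Measurable b) : Measurable fun ω => ∫⁻ t in Set.Ico (a ω : ℝ) (b ω), J t ω := by
  have hset : MeasurableSet {q : Ω × ℝ | (a q.1 : ℝ) ≤ q.2 ∧ q.2 < b q.1} :=
    (measurableSet_le (NNReal.continuous_coe.measurable.comp (ha.comp measurable_fst))
      measurable_snd).inter
    (measurableSet_lt measurable_snd
      (NNReal.continuous_coe.measurable.comp (hb.comp measurable_fst)))
  have h := (hJ.comp measurable_swap).indicator hset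
  have h' := h.lintegral_prod_right' (ν := (volume : Measure ℝ))
  convert h' using 2 with ω
  rw [← lintegral_indicator measurableSet_Ico]
  rfl

/-- Almost surely only finitely many queries reach the source by time `T`. -/
theorem ae_exists_lt_sampleTime (hX : Measurable fun p : ℝ≥0 × Ω => X p.1 p.2)
    (hY : ∀ k, Measurable (Y k)) (hD : ∀ k, Measurable (D k)) (hW : ∀ i, Measurable (W i))
    (T : ℝ≥0) (hfin : ∀ i, visits X Y D W t₀ μ T i ≠ ⊤) :
    ∀ᵐ ω ∂μ, ∃ k, T < sampleTime X Y D W t₀ k ω := by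
  have h1 := lintegral_tsum_sampleTime_le (t₀ := t₀) (μ := μ) hX hY hD hW T
    (f := fun _ _ => 1) (fun _ => measurable_const) (H := fun _ => 1) (fun k i => by simp)
  have h2 : ∫⁻ ω, ∑' k, (if sampleTime X Y D W t₀ k ω ≤ T then (1 : ENNReal) else 0) ∂μ ≠ ⊤ := by
    rw [h1]
    simp [hfin]
  have hm : Measurable fun ω =>
      ∑' k, (if sampleTime X Y D W t₀ k ω ≤ T then (1 : ENNReal) else 0) :=
    Measurable.tsum fun k => measurable_const.ite
      (measurableSet_le (measurable_sampleTime hX hY hD hW k) measurable_const) measurable_const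
  filter_upwards [ae_lt_top hm h2] with ω hω
  by_contra! hall
  simp [hall] at hω

/-- The covering `setLIntegral_le_tsum_cycle` in expectation. Finite visit numbers guarantee that
the sampling times almost surely pass T. -/
theorem lintegral_reward_le (hX : Measurable fun p : ℝ≥0 × Ω => X p.1 p.2)
    (hY : ∀ k, Measurable (Y k)) (hD : ∀ k, Measurable (D k)) (hW : ∀ i, Measurable (W i))
    (T : ℝ≥0) (hfin : ∀ i, visits X Y D W t₀ μ T i ≠ ⊤) {J : ℝ → Ω → ENNReal}
    (hJ : Measurable fun p : ℝ × Ω => J p.1 p.2) (hJ1 : ∀ t ω, J t ω ≤ 1) {H : S → ENNReal}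
    (hH : ∀ k i, ∫⁻ ω in sampleEvent X Y D W t₀ T k i,
        (∫⁻ t in Set.Ico (replyTime X Y D W t₀ k ω : ℝ) (replyTime X Y D W t₀ (k + 1) ω),
          J t ω) ∂μ = μ (sampleEvent X Y D W t₀ T k i) * H i) :
    ∫⁻ ω, (∫⁻ t in Set.Ico (0 : ℝ) T, J t ω) ∂μ ≤
      ∫⁻ ω, (replyTime X Y D W t₀ 0 ω : ENNReal) ∂μ +
        ∑ i, visits X Y D W t₀ μ T i * H i := by
  have hR := fun k => measurable_replyTime (t₀ := t₀) hX hY hD hW k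
  rw [← lintegral_tsum_sampleTime_le hX hY hD hW T
    (fun k => measurable_setLIntegral_Ico hJ (hR k) (hR (k + 1))) hH,
    ← lintegral_add_left (f := fun ω => (replyTime X Y D W t₀ 0 ω : ENNReal))
      (measurable_coe_nnreal_ennreal.comp (hR 0))]
  refine lintegral_mono_ae ?_
  filter_upwards [ae_exists_lt_sampleTime hX hY hD hW T hfin] with ω hω
  exact setLIntegral_le_tsum_cycle (s := fun k => sampleTime X Y D W t₀ k ω)
    (r := fun k => replyTime X Y D W t₀ k ω) (fun k => le_self_add) (fun t => hJ1 t ω) hω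

end Visits

/-! ### Overshoot, linear growth and almost invariance of the visits -/

section Chain

variable {S : Type*} [Fintype S] [DecidableEq S] [MeasurableSpace S] [DiscreteMeasurableSpace S]
variable {Ω : Type*} [MeasurableSpace Ω] {μ : Measure Ω} [IsProbabilityMeasure μ]
  {X : ℝ≥0 → Ω → S} {Y D : ℕ → Ω → ℝ≥0} {FY FD : Measure ℝ≥0}
  {Q : Matrix S S ℝ} {W : S → ℝ≥0 → ℝ≥0} {t₀ : ℝ≥0}

/-- The expectation of `sum_cycle_le`. Replacing the wait by its bound C makes the overshoot term a
function of the delays alone, with the same mean for every state. -/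
theorem le_lintegral_reward_add (hX : IsCTMC Q X μ) (hYD : IsDelaySequence X Y D FY FD μ)
    (hW : ∀ i, Measurable (W i)) {C : ℝ≥0} (hC : ∀ i d, W i d ≤ C) (T b : ℝ≥0)
    {J : ℝ → Ω → ENNReal}
    (hJ : Measurable fun p : ℝ × Ω => J p.1 p.2) (hJ1 : ∀ t ω, J t ω ≤ 1) {H : S → ENNReal}
    (hH : ∀ k i, ∫⁻ ω in sampleEvent X Y D W t₀ T k i,
        (∫⁻ t in Set.Ico (replyTime X Y D W t₀ k ω : ℝ) (replyTime X Y D W t₀ (k + 1) ω),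
          J t ω) ∂μ = μ (sampleEvent X Y D W t₀ T k i) * H i) :
    ∑ i, visits X Y D W t₀ μ T i * H i ≤
      ∫⁻ ω, (∫⁻ t in Set.Ico (0 : ℝ) T, J t ω) ∂μ + b +
        ∑ i, visits X Y D W t₀ μ T i *
          ∫⁻ c, ((c.1 + (C + (c.2.1 + c.2.2)) - b : ℝ≥0) : ENNReal) ∂(FD.prod (FY.prod FD)) := by
  have hXm := measurable_uncurry_of_rightContinuous hX.measurable hX.right_continuous
  have hY := hYD.measurable_forward
  have hD := hYD.measurable_backward
  have hR := fun k => measurable_replyTime (t₀ := t₀) hXm hY hD hW k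
  have hφ : Measurable fun c : ℝ≥0 × ℝ≥0 × ℝ≥0 =>
      ((c.1 + (C + (c.2.1 + c.2.2)) - b : ℝ≥0) : ENNReal) := by fun_prop
  have hcm : ∀ k, Measurable fun ω => (D k ω, Y (k + 1) ω, D (k + 1) ω) := fun k =>
    (hD k).prodMk ((hY _).prodMk (hD _))
  have hmI : Measurable fun ω => ∫⁻ t in Set.Ico (0 : ℝ) T, J t ω := by
    simpa using measurable_setLIntegral_Ico hJ (a := fun _ => 0) (b := fun _ => T)
      measurable_const measurable_const
  rw [← lintegral_tsum_sampleTime_le hXm hY hD hW T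
    (fun k => measurable_setLIntegral_Ico hJ (hR k) (hR (k + 1))) hH,
    ← lintegral_tsum_sampleTime_le hXm hY hD hW T (fun k => hφ.comp (hcm k))
      (fun k i => setLIntegral_sampleEvent_delays hX hYD hW T k i hφ)]
  have hb : ∫⁻ ω, (∫⁻ t in Set.Ico (0 : ℝ) T, J t ω) ∂μ + b =
      ∫⁻ ω, ((∫⁻ t in Set.Ico (0 : ℝ) T, J t ω) + b) ∂μ := by
    rw [lintegral_add_left hmI]
    simp
  rw [hb, ← lintegral_add_left (hmI.add_const _)]
  refine lintegral_mono fun ω => ENNReal.tsum_le_of_sum_range_le fun n => ?_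
  refine (sum_cycle_le (s := fun k => sampleTime X Y D W t₀ k ω)
    (r := fun k => replyTime X Y D W t₀ k ω)
    (u := fun k => D k ω + (C + (Y (k + 1) ω + D (k + 1) ω))) (monotone_sampleTime ω)
    (monotone_replyTime ω) (fun k => ?_) (fun t => hJ1 t ω) T b n).trans ?_
  · rw [replyTime_succ, replyTime, add_assoc (sampleTime _ _ _ _ _ _ _), add_assoc (W _ _)]
    gcongr
    exact hC _ _
  · gcongr
    exact ENNReal.sum_le_tsum _

/-- The expectation of `sum_min_increment_le`; it makes the visit numbers finite and of order at
most T. -/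
theorem sum_visits_mul_le (hX : IsCTMC Q X μ) (hYD : IsDelaySequence X Y D FY FD μ)
    (hW : ∀ i, Measurable (W i)) (T : ℝ≥0) :
    ∑ i, visits X Y D W t₀ μ T i *
      ∫⁻ c, ((min (c.1 + W i c.1 + c.2.1) 1 : ℝ≥0) : ENNReal) ∂(FD.prod (FY.prod FD)) ≤
      T + 1 := by
  have hXm := measurable_uncurry_of_rightContinuous hX.measurable hX.right_continuous
  have hY := hYD.measurable_forward
  have hD := hYD.measurable_backward
  have hφ : ∀ i, Measurable fun c : ℝ≥0 × ℝ≥0 × ℝ≥0 =>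
      ((min (c.1 + W i c.1 + c.2.1) 1 : ℝ≥0) : ENNReal) := fun i =>
    measurable_coe_nnreal_ennreal.comp
      (((measurable_fst.add ((hW i).comp measurable_fst)).add
        (measurable_fst.comp measurable_snd)).min measurable_const)
  have hW' : Measurable fun q : S × ℝ≥0 => W q.1 q.2 := measurable_from_prod_countable_right hW
  rw [← lintegral_tsum_sampleTime_le (t₀ := t₀) (μ := μ) hXm hY hD hW T
    (f := fun k ω => ((min (D k ω + W (X (sampleTime X Y D W t₀ k ω) ω) (D k ω) +
      Y (k + 1) ω) 1 : ℝ≥0) : ENNReal))]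
  · refine (lintegral_mono (g := fun _ => ((T + 1 : ℝ≥0) : ENNReal)) fun ω =>
      ENNReal.tsum_le_of_sum_range_le fun n => ?_).trans (by simp)
    have h := sum_min_increment_le (s := fun k => sampleTime X Y D W t₀ k ω)
      (fun k => sampleTime_succ k ω) T n
    rw [← ENNReal.coe_le_coe] at h
    refine le_trans (le_of_eq ?_) h
    push_cast
    refine Finset.sum_congr rfl fun k _ => ?_
    split_ifs <;> simp
  · intro k
    exact measurable_coe_nnreal_ennreal.comp ((((hD k).add (hW'.comp
      ((measurable_sampledState hXm hY hD hW k).prodMk (hD k)))).add (hY _)).min measurable_const)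
  · intro k i
    rw [← setLIntegral_sampleEvent_delays hX hYD hW T k i (hφ i)]
    refine setLIntegral_congr_fun
      (measurableSet_sampleEvent hXm hY hD hW T k i) fun ω hω => ?_
    simp only [hω.2]

/-- The expected numbers of visits are almost invariant under the transitions of the sampled
chain. -/
theorem visits_le_sum_add_one (hX : IsCTMC Q X μ) (hYD : IsDelaySequence X Y D FY FD μ)
    (hW : ∀ i, Measurable (W i)) (T : ℝ≥0) (j : S) :
    visits X Y D W t₀ μ T j ≤
        ∑ i, visits X Y D W t₀ μ T i * cycleTransition Q W FY FD i j + 1 ∧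
      ∑ i, visits X Y D W t₀ μ T i * cycleTransition Q W FY FD i j ≤
        visits X Y D W t₀ μ T j + 1 := by
  have hXm := measurable_uncurry_of_rightContinuous hX.measurable hX.right_continuous
  have hY := hYD.measurable_forward
  have hD := hYD.measurable_backward
  have hS := fun k => measurable_sampleTime (t₀ := t₀) hXm hY hD hW k
  have hnext : ∀ k, MeasurableSet {ω | X (sampleTime X Y D W t₀ (k + 1) ω) ω = j} := fun k =>
    measurable_sampledState hXm hY hD hW (k + 1) (measurableSet_singleton j)
  have hset : ∀ k, MeasurableSet {ω | sampleTime X Y D W t₀ k ω ≤ T} := fun k =>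
    measurableSet_le (hS k) measurable_const
  have hsum : ∑ i, visits X Y D W t₀ μ T i * cycleTransition Q W FY FD i j =
      ∑' k, μ ({ω | sampleTime X Y D W t₀ k ω ≤ T} ∩
        {ω | X (sampleTime X Y D W t₀ (k + 1) ω) ω = j}) := by
    simp_rw [visits, ← ENNReal.tsum_mul_right]
    rw [← Summable.tsum_finsetSum fun _ _ => ENNReal.summable]
    refine tsum_congr fun k => ?_
    have h := setLIntegral_sampleTime_le (t₀ := t₀) (μ := μ) hXm hY hD hW T k
      ({ω | X (sampleTime X Y D W t₀ (k + 1) ω) ω = j}.indicator 1)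
    simp only [lintegral_indicator_one (hnext k)] at h
    rw [Measure.restrict_apply (hnext k), Set.inter_comm] at h
    rw [h]
    refine Finset.sum_congr rfl fun i _ => ?_
    rw [Measure.restrict_apply (hnext k), Set.inter_comm,
      measure_sampleEvent_inter_next hX hYD hW]
  rw [hsum]
  constructor
  -- The query k = 0 has no predecessor and costs at most one; every other counted query has its
  -- predecessor before T.
  · rw [visits, tsum_eq_zero_add' ENNReal.summable, add_comm]
    refine add_le_add (ENNReal.tsum_le_tsum fun k => measure_mono ?_) prob_le_one
    rintro ω ⟨h1, h2⟩
    exact ⟨(monotone_sampleTime ω k.le_succ).trans h1, h2⟩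
  -- The loss comes from the query after which T is crossed. These crossing events are disjoint in
  -- k, so their probabilities sum to at most one.
  · have hsplit : ∀ k, μ ({ω | sampleTime X Y D W t₀ k ω ≤ T} ∩
        {ω | X (sampleTime X Y D W t₀ (k + 1) ω) ω = j}) ≤
        μ (sampleEvent X Y D W t₀ T (k + 1) j) +
          μ ({ω | sampleTime X Y D W t₀ k ω ≤ T} \ {ω | sampleTime X Y D W t₀ (k + 1) ω ≤ T}) := by
      intro k
      refine (measure_mono ?_).trans (measure_union_le _ _)
      rintro ω ⟨h1, h2⟩
      by_cases h : sampleTime X Y D W t₀ (k + 1) ω ≤ T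
      · exact Or.inl ⟨h, h2⟩
      · exact Or.inr ⟨h1, h⟩
    refine (ENNReal.tsum_le_tsum hsplit).trans ?_
    rw [ENNReal.tsum_add]
    refine add_le_add ?_ ?_
    · exact ENNReal.tsum_comp_le_tsum_of_injective (add_left_injective 1)
        fun k => μ (sampleEvent X Y D W t₀ T k j)
    · rw [← measure_iUnion _ fun k => (hset k).diff (hset (k + 1))]
      · exact prob_le_one
      · have key : ∀ k l, k < l → Disjoint
            ({ω | sampleTime X Y D W t₀ k ω ≤ T} \ {ω | sampleTime X Y D W t₀ (k + 1) ω ≤ T})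
            ({ω | sampleTime X Y D W t₀ l ω ≤ T} \ {ω | sampleTime X Y D W t₀ (l + 1) ω ≤ T}) := by
          intro k l hkl
          refine Set.disjoint_left.2 fun ω h1 h2 => h1.2 ?_
          exact (monotone_sampleTime ω (Nat.succ_le_of_lt hkl)).trans h2.1
        intro k l hkl
        rcases lt_or_gt_of_ne hkl with h | h
        · exact key k l h
        · exact (key l k h).symm

end Chain

/-! ### From inequalities to the long-run rate -/

section Asymptotics

theorem tendsto_div_of_abs_sub_le {A : ℝ → ℝ} {r : ℝ}
    (h : ∀ δ > 0, ∃ B, ∀ T > 0, |A T - r * T| ≤ B + δ * T) :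
    Tendsto (fun T => 1 / T * A T) atTop (𝓝 r) := by
  rw [Metric.tendsto_atTop]
  intro η hη
  obtain ⟨B, hB⟩ := h (η / 2) (by positivity)
  refine ⟨max 1 (2 * |B| / η + 1), fun T hT => ?_⟩
  have hT1 : 1 ≤ T := (le_max_left _ _).trans hT
  have hT0 : 0 < T := by linarith
  have hT2 : 2 * |B| / η < T := by linarith [(le_max_right _ _).trans hT]
  have h1 : 1 / T * A T - r = (A T - r * T) / T := by field_simp
  rw [Real.dist_eq, h1, abs_div, abs_of_pos hT0, div_lt_iff₀ hT0]
  rw [div_lt_iff₀ hη] at hT2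
  have := hB T hT0
  have := le_abs_self B
  nlinarith

variable {S : Type*} [Fintype S] [Nonempty S] {K : Matrix S S ℝ} {ε : ℝ}

/-- An almost invariant measure of a strictly positive stochastic matrix is close to a multiple of
the stationary law. -/
theorem abs_sum_mul_sub_le (hε : 0 < ε) (hK : ∀ i j, ε ≤ K i j) (hsum : ∀ i, ∑ j, K i j = 1)
    {φ : S → ℝ} (hφ : IsStationary K φ) {a : S → ℝ}
    (ha : ∀ j, |a j - ∑ i, a i * K i j| ≤ 1) (f : S → ℝ) :
    |∑ i, a i * f i - (∑ i, a i) * ∑ i, φ i * f i| ≤ (∑ i, |f i|) / ε := by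
  -- w is a minus the multiple of φ with the same mass. It has zero mass and, φ being stationary,
  -- the same invariance defect as a.
  set w : S → ℝ := fun i => a i - (∑ i, a i) * φ i with hw
  have hw0 : ∑ i, w i = 0 := by
    simp only [hw]
    rw [Finset.sum_sub_distrib, ← Finset.mul_sum, hφ.2, mul_one, sub_self]
  have hwK : ∀ j, w j - ∑ i, w i * K i j = a j - ∑ i, a i * K i j := by
    intro j
    simp only [hw, sub_mul, Finset.sum_sub_distrib, mul_assoc, ← Finset.mul_sum, hφ.1]
    ring
  have h1 := sum_abs_le_of_zero_sum hK hsum hw0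
  simp only [hwK] at h1
  have h2 : ∑ j, |a j - ∑ i, a i * K i j| ≤ Fintype.card S := by
    refine (Finset.sum_le_sum fun j _ => ha j).trans ?_
    simp
  have hc : (0 : ℝ) < Fintype.card S := by exact_mod_cast Fintype.card_pos
  have h3 : ε * ∑ i, |w i| ≤ 1 := by
    have : (Fintype.card S : ℝ) * (ε * ∑ i, |w i|) ≤ Fintype.card S * 1 := by
      rw [← mul_assoc]; linarith
    exact le_of_mul_le_mul_left this hc
  have h4 : ∑ i, a i * f i - (∑ i, a i) * ∑ i, φ i * f i = ∑ i, w i * f i := by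
    simp only [hw, sub_mul, Finset.sum_sub_distrib, mul_assoc, ← Finset.mul_sum]
  rw [h4, le_div_iff₀ hε]
  have h5 : |∑ i, w i * f i| ≤ (∑ i, |w i|) * ∑ i, |f i| := by
    refine (Finset.abs_sum_le_sum_abs _ _).trans ?_
    rw [Finset.sum_mul]
    refine Finset.sum_le_sum fun i _ => ?_
    rw [abs_mul]
    exact mul_le_mul_of_nonneg_left
      (Finset.single_le_sum (f := fun i => |f i|) (fun _ _ => abs_nonneg _) (Finset.mem_univ i))
      (abs_nonneg _)
  have hf : 0 ≤ ∑ i, |f i| := Finset.sum_nonneg fun _ _ => abs_nonneg _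
  have h6 := mul_le_mul_of_nonneg_right h3 hf
  nlinarith

/-- The long-run reward rate of a Markov renewal process, from inequalities between the expected
reward and the expected numbers of visits up to time `T`. -/
theorem tendsto_reward_rate (hε : 0 < ε) (hK : ∀ i j, ε ≤ K i j) (hsum : ∀ i, ∑ j, K i j = 1)
    {φ : S → ℝ} (hφ : IsStationary K φ) (hφ0 : ∀ i, 0 ≤ φ i) {g l : S → ℝ} (hg : ∀ i, 0 ≤ g i)
    (hl : ∀ i, 0 < l i) {A : ℝ → ℝ} {a : ℝ → S → ℝ}
    (ha : ∀ T > 0, ∀ j, |a T j - ∑ i, a T i * K i j| ≤ 1)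
    (ha0 : ∀ T > 0, 0 ≤ ∑ i, a T i) {c ρ : ℝ} (hc : 0 < c) (hac : ∀ T > 0, c * ∑ i, a T i ≤ T + 1)
    (hup : ∀ T > 0, A T ≤ ρ + ∑ i, a T i * g i) (hup' : ∀ T > 0, T ≤ ρ + ∑ i, a T i * l i)
    (hlow : ∀ δ > 0, ∃ b, ∀ T > 0, ∑ i, a T i * g i ≤ A T + b + δ * ∑ i, a T i ∧
      ∑ i, a T i * l i ≤ T + b + δ * ∑ i, a T i) :
    Tendsto (fun T => 1 / T * A T) atTop (𝓝 ((∑ i, φ i * g i) / ∑ i, φ i * l i)) := by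
  have hlpos : 0 < ∑ i, φ i * l i := by
    have hne : ∃ i, φ i ≠ 0 := by
      by_contra! h0
      have := hφ.2
      simp [h0] at this
    obtain ⟨i, hi⟩ := hne
    exact Finset.sum_pos' (fun i _ => mul_nonneg (hφ0 i) (hl i).le)
      ⟨i, Finset.mem_univ i, mul_pos (lt_of_le_of_ne (hφ0 i) hi.symm) (hl i)⟩
  have hgnn : 0 ≤ ∑ i, φ i * g i := Finset.sum_nonneg fun i _ => mul_nonneg (hφ0 i) (hg i)
  set G := ∑ i, φ i * g i
  set L := ∑ i, φ i * l i
  set r := G / L with hr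
  have hr0 : 0 ≤ r := by positivity
  have hrL : r * L = G := by rw [hr]; field_simp
  refine tendsto_div_of_abs_sub_le fun δ hδ => ?_
  -- The overshoot error enters with weight 1 from the rewards and r from the lengths. Since c N ≤ T
  -- + 1, this choice bounds the total by δ (T + 1), whence the extra δ in the constant below.
  obtain ⟨b, hb⟩ := hlow (δ * c / (1 + r)) (by positivity)
  set Mg := (∑ i, |g i|) / ε
  set Ml := (∑ i, |l i|) / ε
  have hMg : 0 ≤ Mg := div_nonneg (Finset.sum_nonneg fun _ _ => abs_nonneg _) hε.le
  have hMl : 0 ≤ Ml := div_nonneg (Finset.sum_nonneg fun _ _ => abs_nonneg _) hε.le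
  refine ⟨(1 + r) * (|ρ| + Mg + Ml + |b|) + δ, fun T hT => ?_⟩
  have hag := abs_le.1 (abs_sum_mul_sub_le hε hK hsum hφ (ha T hT) g)
  have hal := abs_le.1 (abs_sum_mul_sub_le hε hK hsum hφ (ha T hT) l)
  obtain ⟨hb1, hb2⟩ := hb T hT
  have h1 := hup T hT
  have h2 := hup' T hT
  have h3 := hac T hT
  have h4 := ha0 T hT
  change -Mg ≤ ∑ i, a T i * g i - (∑ i, a T i) * G ∧
    ∑ i, a T i * g i - (∑ i, a T i) * G ≤ Mg at hag
  change -Ml ≤ ∑ i, a T i * l i - (∑ i, a T i) * L ∧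
    ∑ i, a T i * l i - (∑ i, a T i) * L ≤ Ml at hal
  generalize (∑ i, a T i * g i) = ag at *
  generalize (∑ i, a T i * l i) = al at *
  generalize (∑ i, a T i) = N at *
  have hv : (1 + r) * (δ * c / (1 + r) * N) ≤ δ * (T + 1) := by
    have : (1 + r) * (δ * c / (1 + r) * N) = δ * (c * N) := by field_simp
    rw [this]
    exact mul_le_mul_of_nonneg_left h3 hδ.le
  have hV : 0 ≤ δ * c / (1 + r) * N := mul_nonneg (by positivity) h4
  generalize δ * c / (1 + r) * N = V at *
  have hρ := le_abs_self ρ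
  have hbb := le_abs_self b
  -- As r L = G, bounds on T in terms of N L become bounds on r T in terms of N G, and N cancels.
  have hNL : r * (N * L) = N * G := by rw [← hrL]; ring
  have e1 : r * (N * L - Ml - b - V) ≤ r * T := mul_le_mul_of_nonneg_left (by linarith) hr0
  have e2 : r * T ≤ r * (ρ + N * L + Ml) := mul_le_mul_of_nonneg_left (by linarith) hr0
  have m1 : r * ρ ≤ r * |ρ| := mul_le_mul_of_nonneg_left hρ hr0
  have m2 : r * b ≤ r * |b| := mul_le_mul_of_nonneg_left hbb hr0
  have m3 : 0 ≤ r * Ml := mul_nonneg hr0 hMl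
  have m4 : 0 ≤ r * Mg := mul_nonneg hr0 hMg
  have m5 : 0 ≤ r * V := mul_nonneg hr0 hV
  have m6 : 0 ≤ r * |ρ| := by positivity
  have m7 : 0 ≤ r * |b| := by positivity
  have m8 := abs_nonneg ρ
  have m9 := abs_nonneg b
  rw [abs_le]
  constructor <;> linarith

end Asymptotics

/-! ### Bochner integrals as lower Lebesgue integrals -/

section Integrals

theorem intervalIntegral_eq_toReal_setLIntegral {f : ℝ → ℝ} (hf : Measurable f) {a b : ℝ}
    (hab : a ≤ b) (h0 : ∀ t ∈ Set.Ico a b, 0 ≤ f t) :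
    ∫ t in a..b, f t = (∫⁻ t in Set.Ico a b, ENNReal.ofReal (f t)).toReal := by
  rw [intervalIntegral.integral_of_le hab, ← integral_Ico_eq_integral_Ioc,
    integral_eq_lintegral_of_nonneg_ae _ hf.aestronglyMeasurable]
  exact (ae_restrict_iff' measurableSet_Ico).2 (Eventually.of_forall h0)

variable {S : Type*} [Fintype S] [MeasurableSpace S] [DiscreteMeasurableSpace S]
variable {Ω : Type*} [MeasurableSpace Ω]

theorem measurable_correct [DecidableEq S] {X Xhat : ℝ≥0 → Ω → S} (hX : Measurable fun p : ℝ≥0 × Ω => X p.1 p.2)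
    (hXhat : Measurable fun p : ℝ≥0 × Ω => Xhat p.1 p.2) :
    Measurable fun p : ℝ × Ω => correct X Xhat p.1 p.2 := by
  have hm : Measurable fun p : ℝ × Ω => (p.1.toNNReal, p.2) :=
    (measurable_real_toNNReal.comp measurable_fst).prodMk measurable_snd
  exact Measurable.ite (measurableSet_eq_fun (hX.comp hm) (hXhat.comp hm)) measurable_const
    measurable_const

omit [Fintype S] [MeasurableSpace S] [DiscreteMeasurableSpace S] [MeasurableSpace Ω] in
theorem correct_le_one [DecidableEq S] (X Xhat : ℝ≥0 → Ω → S) (t : ℝ) (ω : Ω) :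
    correct X Xhat t ω ≤ 1 := by
  rw [correct]; split_ifs <;> simp

theorem integral_correct [DecidableEq S] {μ : Measure Ω} [IsProbabilityMeasure μ]
    {X Xhat : ℝ≥0 → Ω → S}
    (hX : Measurable fun p : ℝ≥0 × Ω => X p.1 p.2)
    (hXhat : Measurable fun p : ℝ≥0 × Ω => Xhat p.1 p.2) (T : ℝ≥0) :
    ∫ ω, (∫ t in (0 : ℝ)..T, if X t.toNNReal ω = Xhat t.toNNReal ω then (1 : ℝ) else 0) ∂μ =
      (∫⁻ ω, (∫⁻ t in Set.Ico (0 : ℝ) T, correct X Xhat t ω) ∂μ).toReal := by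
  have hm := measurable_correct hX hXhat
  have hmI : Measurable fun ω => ∫⁻ t in Set.Ico (0 : ℝ) T, correct X Xhat t ω := by
    simpa using measurable_setLIntegral_Ico hm (a := fun _ => 0) (b := fun _ => T)
      measurable_const measurable_const
  rw [← integral_toReal hmI.aemeasurable]
  · refine integral_congr_ae (Eventually.of_forall fun ω => ?_)
    have hreal : ∀ t : ℝ, (if X t.toNNReal ω = Xhat t.toNNReal ω then (1 : ℝ) else 0) =
        (correct X Xhat t ω).toReal := fun t => by rw [correct]; split_ifs <;> simp
    simp only [hreal]
    have hmω : Measurable fun t : ℝ => (correct X Xhat t ω).toReal :=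
      (hm.comp (measurable_id.prodMk measurable_const)).ennreal_toReal
    rw [intervalIntegral_eq_toReal_setLIntegral hmω (NNReal.coe_nonneg T) fun t _ => ENNReal.toReal_nonneg]
    congr 1
    refine lintegral_congr fun t => ENNReal.ofReal_toReal ?_
    exact ne_top_of_le_ne_top ENNReal.one_ne_top (correct_le_one X Xhat t ω)
  · refine Eventually.of_forall fun ω => ?_
    refine (setLIntegral_Ico_le (fun t => correct_le_one X Xhat t ω) 0 T).trans_lt ?_
    exact ENNReal.coe_lt_top

theorem integral_prod_pmf (φ : PMF S) {α : Type*} [MeasurableSpace α] (ν : Measure α) [SFinite ν]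
    {F : S × α → ℝ} (hF : ∀ i, Measurable fun c => F (i, c))
    (hint : ∀ i, Integrable (fun c => F (i, c)) ν) :
    ∫ q, F q ∂(φ.toMeasure.prod ν) = ∑ i, (φ i).toReal * ∫ c, F (i, c) ∂ν := by
  have hm : Measurable F := measurable_from_prod_countable_right hF
  have hi : Integrable F (φ.toMeasure.prod ν) := by
    rw [integrable_prod_iff hm.aestronglyMeasurable]
    exact ⟨Eventually.of_forall hint, Integrable.of_finite⟩
  rw [integral_prod _ hi, PMF.integral_eq_sum]
  simp

end Integrals

/-! ### Means over the delays of a cycle and positivity of the embedded kernel -/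

section CycleMeans

variable {S : Type*} {W : S → ℝ≥0 → ℝ≥0} {FY FD : Measure ℝ≥0}
  [IsProbabilityMeasure FY] [IsProbabilityMeasure FD]

theorem integral_cycle_fst (f : ℝ≥0 → ℝ) :
    ∫ c, f c.1 ∂(FD.prod (FY.prod FD)) = ∫ d, f d ∂FD := by
  rw [integral_fun_fst]; simp

theorem integral_cycle_snd (f : ℝ≥0 → ℝ) :
    ∫ c, f c.2.1 ∂(FD.prod (FY.prod FD)) = ∫ y, f y ∂FY := by
  rw [integral_fun_snd (fun q : ℝ≥0 × ℝ≥0 => f q.1), integral_fun_fst]; simp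

theorem integral_cycle_thd (f : ℝ≥0 → ℝ) :
    ∫ c, f c.2.2 ∂(FD.prod (FY.prod FD)) = ∫ d, f d ∂FD := by
  rw [integral_fun_snd (fun q : ℝ≥0 × ℝ≥0 => f q.2), integral_fun_snd]; simp

theorem integrable_cycle_fst {f : ℝ≥0 → ℝ} (hf : Integrable f FD) :
    Integrable (fun c => f c.1) (FD.prod (FY.prod FD)) := hf.comp_fst _

theorem integrable_cycle_snd {f : ℝ≥0 → ℝ} (hf : Integrable f FY) :
    Integrable (fun c => f c.2.1) (FD.prod (FY.prod FD)) :=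
  Integrable.comp_snd (f := fun q : ℝ≥0 × ℝ≥0 => f q.1) (hf.comp_fst FD) FD

theorem integrable_cycle_thd {f : ℝ≥0 → ℝ} (hf : Integrable f FD) :
    Integrable (fun c => f c.2.2) (FD.prod (FY.prod FD)) :=
  Integrable.comp_snd (f := fun q : ℝ≥0 × ℝ≥0 => f q.2) (hf.comp_snd FY) FD

theorem integrable_wait (hW : ∀ i, Measurable (W i)) {C : ℝ≥0} (hC : ∀ i d, W i d ≤ C) (i : S) :
    Integrable (fun d => (W i d : ℝ)) FD :=
  Integrable.of_bound (NNReal.continuous_coe.measurable.comp (hW i)).aestronglyMeasurable C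
    (Eventually.of_forall fun d => by
      rw [Real.norm_eq_abs, NNReal.abs_eq]; exact_mod_cast hC i d)

/-- The time between consecutive samples does not vanish almost surely. -/
theorem not_ae_cycle_eq_zero {i : S}
    (hpos : 0 < (∫ d, (W i d : ℝ) ∂FD) + ((∫ y, (y : ℝ) ∂FY) + ∫ d, (d : ℝ) ∂FD)) :
    ¬ ∀ᵐ c ∂(FD.prod (FY.prod FD)), c.1 + W i c.1 + c.2.1 = 0 := by
  -- The three nonnegative summands would vanish separately, and so would their means. The first
  -- coordinate is the delay of the previous reply; it has the law `FD` that appears in `hpos`.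
  intro h
  have h1 : ∫ c, (W i c.1 : ℝ) ∂(FD.prod (FY.prod FD)) = 0 := by
    rw [← integral_zero (ℝ≥0 × ℝ≥0 × ℝ≥0) ℝ]
    refine integral_congr_ae ?_
    filter_upwards [h] with c hc
    simp only [add_eq_zero] at hc
    simp [hc.1.2]
  have h2 : ∫ c, (c.1 : ℝ) ∂(FD.prod (FY.prod FD)) = 0 := by
    rw [← integral_zero (ℝ≥0 × ℝ≥0 × ℝ≥0) ℝ]
    refine integral_congr_ae ?_
    filter_upwards [h] with c hc
    simp only [add_eq_zero] at hc
    simp [hc.1.1]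
  have h3 : ∫ c, (c.2.1 : ℝ) ∂(FD.prod (FY.prod FD)) = 0 := by
    rw [← integral_zero (ℝ≥0 × ℝ≥0 × ℝ≥0) ℝ]
    refine integral_congr_ae ?_
    filter_upwards [h] with c hc
    simp only [add_eq_zero] at hc
    simp [hc.2]
  rw [integral_cycle_fst (fun d => (W i d : ℝ))] at h1
  rw [integral_cycle_fst (fun d => (d : ℝ))] at h2
  rw [integral_cycle_snd (fun d => (d : ℝ))] at h3
  linarith

theorem cycleLength_eq (hW : ∀ i, Measurable (W i)) {C : ℝ≥0} (hC : ∀ i d, W i d ≤ C)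
    (hY : Integrable (fun y : ℝ≥0 => (y : ℝ)) FY) (hD : Integrable (fun d : ℝ≥0 => (d : ℝ)) FD)
    (i : S) : cycleLength W FY FD i =
      ENNReal.ofReal ((∫ d, (W i d : ℝ) ∂FD) + ((∫ y, (y : ℝ) ∂FY) + ∫ d, (d : ℝ) ∂FD)) := by
  have h1 : Integrable (fun c => (W i c.1 : ℝ)) (FD.prod (FY.prod FD)) :=
    integrable_cycle_fst (integrable_wait hW hC i)
  have h2 : Integrable (fun c => (c.2.1 : ℝ)) (FD.prod (FY.prod FD)) := integrable_cycle_snd hY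
  have h3 : Integrable (fun c => (c.2.2 : ℝ)) (FD.prod (FY.prod FD)) := integrable_cycle_thd hD
  have h23 : Integrable (fun c => (c.2.1 : ℝ) + c.2.2) (FD.prod (FY.prod FD)) := h2.add h3
  rw [cycleLength, lintegral_coe_eq_integral]
  · congr 1
    push_cast
    rw [integral_add h1 h23, integral_add h2 h3,
      integral_cycle_fst (fun d => (W i d : ℝ)), integral_cycle_snd (fun y => (y : ℝ)),
      integral_cycle_thd (fun d => (d : ℝ))]
  · push_cast
    exact h1.add (h2.add h3)

/-- The mean overshoot beyond a large level is small. -/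
theorem exists_overshoot_le (hY : Integrable (fun y : ℝ≥0 => (y : ℝ)) FY)
    (hD : Integrable (fun d : ℝ≥0 => (d : ℝ)) FD) (C : ℝ≥0) {δ : ℝ} (hδ : 0 < δ) :
    ∃ b : ℝ≥0, ∫⁻ c, ((c.1 + (C + (c.2.1 + c.2.2)) - b : ℝ≥0) : ENNReal)
      ∂(FD.prod (FY.prod FD)) ≤ ENNReal.ofReal δ := by
  have hfin : ∫⁻ c, ((c.1 + (C + (c.2.1 + c.2.2)) : ℝ≥0) : ENNReal) ∂(FD.prod (FY.prod FD)) ≠ ⊤ := by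
    rw [lintegral_coe_eq_integral]
    · exact ENNReal.ofReal_ne_top
    · push_cast
      exact (integrable_cycle_fst hD).add ((integrable_const _).add
        ((integrable_cycle_snd hY).add (integrable_cycle_thd hD)))
  have hlim : Tendsto (fun n : ℕ => ∫⁻ c, ((c.1 + (C + (c.2.1 + c.2.2)) - (n : ℝ≥0) : ℝ≥0) : ENNReal)
      ∂(FD.prod (FY.prod FD))) atTop (𝓝 (∫⁻ _, 0 ∂(FD.prod (FY.prod FD)))) := by
    refine tendsto_lintegral_of_dominated_convergence
      (fun c => ((c.1 + (C + (c.2.1 + c.2.2)) : ℝ≥0) : ENNReal)) (fun n => by fun_prop)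
      (fun n => Eventually.of_forall fun c => ?_) hfin (Eventually.of_forall fun c => ?_)
    · exact ENNReal.coe_le_coe.2 tsub_le_self
    · refine tendsto_const_nhds.congr' ?_
      obtain ⟨m, hm⟩ := exists_nat_ge (c.1 + (C + (c.2.1 + c.2.2)))
      filter_upwards [eventually_ge_atTop m] with n hn
      have : c.1 + (C + (c.2.1 + c.2.2)) ≤ (n : ℝ≥0) := hm.trans (by exact_mod_cast hn)
      rw [tsub_eq_zero_of_le this]
      simp
  rw [lintegral_zero] at hlim
  obtain ⟨n, hn⟩ := (hlim.eventually (ge_mem_nhds (ENNReal.ofReal_pos.2 hδ))).exists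
  exact ⟨n, hn⟩

variable [Fintype S] [DecidableEq S] {Q : Matrix S S ℝ}

theorem integrable_cycle_transition (hQ : IsGenerator Q) (hW : ∀ i, Measurable (W i)) (i j : S) :
    Integrable (fun c : ℝ≥0 × ℝ≥0 × ℝ≥0 =>
      transitionMatrix Q ((c.1 + W i c.1 + c.2.1 : ℝ≥0) : ℝ) i j) (FD.prod (FY.prod FD)) := by
  refine Integrable.of_bound (Measurable.aestronglyMeasurable ?_) 1
    (Eventually.of_forall fun c => ?_)
  · exact (continuous_transitionMatrix Q i j).measurable.comp
      (NNReal.continuous_coe.measurable.comp ((measurable_fst.add ((hW i).comp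
        measurable_fst)).add (measurable_fst.comp measurable_snd)))
  · rw [Real.norm_eq_abs, abs_of_nonneg (transitionMatrix_nonneg Q hQ (NNReal.coe_nonneg _) i j)]
    exact transitionMatrix_le_one Q hQ (NNReal.coe_nonneg _) i j

theorem embeddedKernel_eq (hQ : IsGenerator Q) (hW : ∀ i, Measurable (W i)) (i j : S) :
    embeddedKernel Q W FY FD i j = ∫ c, transitionMatrix Q ((c.1 + W i c.1 + c.2.1 : ℝ≥0) : ℝ) i j
      ∂(FD.prod (FY.prod FD)) := by
  rw [integral_prod _ (integrable_cycle_transition hQ hW i j), embeddedKernel]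
  refine integral_congr_ae (Eventually.of_forall fun d => ?_)
  simp only
  rw [integral_fun_fst (fun y : ℝ≥0 => transitionMatrix Q ((d + W i d + y : ℝ≥0) : ℝ) i j)]
  simp

theorem cycleTransition_eq (hQ : IsGenerator Q) (hW : ∀ i, Measurable (W i)) (i j : S) :
    cycleTransition Q W FY FD i j = ENNReal.ofReal (embeddedKernel Q W FY FD i j) := by
  rw [embeddedKernel_eq hQ hW, ofReal_integral_eq_lintegral_ofReal
    (integrable_cycle_transition hQ hW i j)
    (Eventually.of_forall fun c => transitionMatrix_nonneg Q hQ (NNReal.coe_nonneg _) i j)]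
  rfl

theorem embeddedKernel_sum (hQ : IsGenerator Q) (hW : ∀ i, Measurable (W i)) (i : S) :
    ∑ j, embeddedKernel Q W FY FD i j = 1 := by
  simp_rw [embeddedKernel_eq hQ hW]
  rw [← integral_finsetSum _ fun j _ => integrable_cycle_transition hQ hW i j]
  simp [transitionMatrix_sum Q hQ]

/-- Transition probabilities are positive at positive times, so a zero mean would force the time
between samples to vanish almost surely. -/
theorem embeddedKernel_pos (hQ : IsGenerator Q) (hirr : QuerySampling.IsIrreducible Q)
    (hW : ∀ i, Measurable (W i)) {i : S}
    (hpos : 0 < (∫ d, (W i d : ℝ) ∂FD) + ((∫ y, (y : ℝ) ∂FY) + ∫ d, (d : ℝ) ∂FD)) (j : S) :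
    0 < embeddedKernel Q W FY FD i j := by
  have hnn : ∀ c : ℝ≥0 × ℝ≥0 × ℝ≥0,
      0 ≤ transitionMatrix Q ((c.1 + W i c.1 + c.2.1 : ℝ≥0) : ℝ) i j := fun c =>
    transitionMatrix_nonneg Q hQ (NNReal.coe_nonneg _) i j
  rw [embeddedKernel_eq hQ hW]
  refine lt_of_le_of_ne (integral_nonneg hnn) fun h => not_ae_cycle_eq_zero hpos ?_
  have h0 := (integral_eq_zero_iff_of_nonneg hnn (integrable_cycle_transition hQ hW i j)).1 h.symm
  filter_upwards [h0] with c hc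
  by_contra hne
  exact (transitionMatrix_pos Q hQ hirr (NNReal.coe_pos.2 (pos_iff_ne_zero.2 hne)) i j).ne' hc

omit [IsProbabilityMeasure FY] [IsProbabilityMeasure FD] in
theorem cycleReward_le_cycleLength (hQ : IsGenerator Q) (e : S → ℝ≥0 → S) (i : S) :
    cycleReward Q W FY FD e i ≤ cycleLength W FY FD i := by
  refine lintegral_mono fun c => (setLIntegral_Ico_le (fun t => ?_) _ _).trans ?_
  · exact ENNReal.ofReal_le_one.2 (transitionMatrix_le_one Q hQ (NNReal.coe_nonneg _) _ _)
  · rw [add_tsub_cancel_left]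

end CycleMeans

/-! ### Convergence of the mean freshness -/

section Freshness

variable {S : Type*} [Fintype S] [DecidableEq S] [MeasurableSpace S] [DiscreteMeasurableSpace S]
variable {Ω : Type*} [MeasurableSpace Ω] {μ : Measure Ω} [IsProbabilityMeasure μ]
  {X : ℝ≥0 → Ω → S} {Y D : ℕ → Ω → ℝ≥0} {FY FD : Measure ℝ≥0}
  [IsProbabilityMeasure FY] [IsProbabilityMeasure FD]
  {Q : Matrix S S ℝ} {W : S → ℝ≥0 → ℝ≥0} {t₀ : ℝ≥0}

omit [Fintype S] [DecidableEq S] [DiscreteMeasurableSpace S] [IsProbabilityMeasure FY]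
  [IsProbabilityMeasure FD] in
theorem lintegral_replyTime_zero_ne_top (hYD : IsDelaySequence X Y D FY FD μ) :
    ∫⁻ ω, (replyTime X Y D W t₀ 0 ω : ENNReal) ∂μ ≠ ⊤ := by
  have hm : Measurable fun y : ℝ≥0 => (y : ℝ) := NNReal.continuous_coe.measurable
  have hY : Integrable (fun ω => (Y 0 ω : ℝ)) μ := by
    have h := hYD.integrable_forward
    rw [← hYD.law_forward 0] at h
    exact (integrable_map_measure hm.aestronglyMeasurable
      (hYD.measurable_forward 0).aemeasurable).1 h
  have hD : Integrable (fun ω => (D 0 ω : ℝ)) μ := by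
    have h := hYD.integrable_backward
    rw [← hYD.law_backward 0] at h
    exact (integrable_map_measure hm.aestronglyMeasurable
      (hYD.measurable_backward 0).aemeasurable).1 h
  rw [lintegral_coe_eq_integral]
  · exact ENNReal.ofReal_ne_top
  · simp only [replyTime, sampleTime]
    push_cast
    exact ((integrable_const _).add hY).add hD

/-- The constant is the least of the mean truncated increments: nonzero because no increment
vanishes almost surely, finite because of the truncation at one. -/
theorem exists_mul_sum_visits_le [Nonempty S] (hX : IsCTMC Q X μ)
    (hYD : IsDelaySequence X Y D FY FD μ) (hW : ∀ i, Measurable (W i))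
    (hpos : ∀ i, 0 < (∫ d, (W i d : ℝ) ∂FD) + ((∫ y, (y : ℝ) ∂FY) + ∫ d, (d : ℝ) ∂FD)) :
    ∃ c : ENNReal, c ≠ 0 ∧ c ≠ ⊤ ∧
      ∀ T : ℝ≥0, c * ∑ i, visits X Y D W t₀ μ T i ≤ T + 1 := by
  let m : S → ENNReal := fun i =>
    ∫⁻ c, ((min (c.1 + W i c.1 + c.2.1) 1 : ℝ≥0) : ENNReal) ∂(FD.prod (FY.prod FD))
  have hm0 : ∀ i, m i ≠ 0 := by
    intro i h
    have hmeas : Measurable fun c : ℝ≥0 × ℝ≥0 × ℝ≥0 =>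
        ((min (c.1 + W i c.1 + c.2.1) 1 : ℝ≥0) : ENNReal) :=
      measurable_coe_nnreal_ennreal.comp
        (((measurable_fst.add ((hW i).comp measurable_fst)).add
          (measurable_fst.comp measurable_snd)).min measurable_const)
    rw [lintegral_eq_zero_iff hmeas] at h
    refine not_ae_cycle_eq_zero (hpos i) ?_
    filter_upwards [h] with c hc
    simp only [Pi.zero_apply, ENNReal.coe_eq_zero] at hc
    rcases min_choice (c.1 + W i c.1 + c.2.1) 1 with h' | h'
    · rwa [h'] at hc
    · rw [h'] at hc; exact absurd hc one_ne_zero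
  have hm1 : ∀ i, m i ≤ 1 := by
    intro i
    refine (lintegral_mono (g := fun _ => 1) fun c => ?_).trans (by simp)
    exact ENNReal.coe_le_one_iff.2 (min_le_right _ _)
  obtain ⟨i₀, hi₀⟩ := Finite.exists_min m
  refine ⟨m i₀, hm0 i₀, ne_top_of_le_ne_top ENNReal.one_ne_top (hm1 i₀), fun T => ?_⟩
  refine le_trans ?_ (sum_visits_mul_le (t₀ := t₀) hX hYD hW T)
  rw [Finset.mul_sum]
  exact Finset.sum_le_sum fun i _ => by rw [mul_comm]; gcongr; exact hi₀ i

omit [DecidableEq S] [MeasurableSpace S] [DiscreteMeasurableSpace S] in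
theorem toReal_sum_mul {a H : S → ENNReal} (ha : ∀ i, a i ≠ ⊤) (hH : ∀ i, H i ≠ ⊤) :
    (∑ i, a i * H i).toReal = ∑ i, (a i).toReal * (H i).toReal := by
  rw [ENNReal.toReal_sum fun i _ => ENNReal.mul_ne_top (ha i) (hH i)]
  simp_rw [ENNReal.toReal_mul]

/-- The long-run fraction of time during which the estimate is correct. -/
theorem tendsto_meanFreshness [Nonempty S] (hQ : IsGenerator Q)
    (hX : IsCTMC Q X μ) (hYD : IsDelaySequence X Y D FY FD μ)
    (hW : ∀ i, Measurable (W i)) {C : ℝ≥0} (hC : ∀ i d, W i d ≤ C)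
    (hpos : ∀ i, 0 < (∫ d, (W i d : ℝ) ∂FD) + ((∫ y, (y : ℝ) ∂FY) + ∫ d, (d : ℝ) ∂FD))
    {e₀ : ℝ≥0 → S} (he₀ : Measurable e₀) {e : S → ℝ≥0 → S} (he : ∀ i, Measurable (e i))
    {ε : ℝ} (hε : 0 < ε) (hK : ∀ i j, ε ≤ embeddedKernel Q W FY FD i j)
    {φ : S → ℝ} (hφ : IsStationary (embeddedKernel Q W FY FD) φ) (hφ0 : ∀ i, 0 ≤ φ i) :
    Tendsto (fun T : ℝ => (1 / T) * ∫ ω, (∫ t in (0 : ℝ)..T,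
        if X t.toNNReal ω = estimate X Y D W t₀ e₀ e t.toNNReal ω then (1 : ℝ) else 0) ∂μ) atTop
      (𝓝 ((∑ i, φ i * (cycleReward Q W FY FD e i).toReal) /
        ∑ i, φ i * (cycleLength W FY FD i).toReal)) := by
  have hXm := measurable_uncurry_of_rightContinuous hX.measurable hX.right_continuous
  have hY := hYD.measurable_forward
  have hD := hYD.measurable_backward
  have hest := measurable_estimate (t₀ := t₀) hXm hY hD hW he₀ he
  have hJ := measurable_correct hXm hest
  have hJ1 := correct_le_one X (estimate X Y D W t₀ e₀ e)
  have hlen := cycleLength_eq hW hC hYD.integrable_forward hYD.integrable_backward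
  have hltop : ∀ i, cycleLength W FY FD i ≠ ⊤ := fun i => by
    rw [hlen]; exact ENNReal.ofReal_ne_top
  have hgtop : ∀ i, cycleReward Q W FY FD e i ≠ ⊤ := fun i =>
    ne_top_of_le_ne_top (hltop i) (cycleReward_le_cycleLength hQ e i)
  have hlpos : ∀ i, 0 < (cycleLength W FY FD i).toReal := fun i => by
    rw [hlen, ENNReal.toReal_ofReal (hpos i).le]; exact hpos i
  obtain ⟨c, hc0, hctop, hc⟩ := exists_mul_sum_visits_le (t₀ := t₀) hX hYD hW hpos
  have hsumtop : ∀ T, ∑ i, visits X Y D W t₀ μ T i ≠ ⊤ := by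
    intro T h
    have h1 := hc T
    rw [h, ENNReal.mul_top hc0] at h1
    exact absurd h1 (not_le.2 (by finiteness))
  have htop : ∀ T i, visits X Y D W t₀ μ T i ≠ ⊤ := fun T i =>
    ne_top_of_le_ne_top (hsumtop T)
      (Finset.single_le_sum (f := fun i => visits X Y D W t₀ μ T i) (fun _ _ => zero_le)
        (Finset.mem_univ i))
  -- Cycle lengths are the rewards of the constant integrand one, so the same two bounds will
  -- compare T itself with the visit numbers.
  have hHlen : ∀ (T : ℝ≥0) k i, ∫⁻ ω in sampleEvent X Y D W t₀ T k i,
      (∫⁻ t in Set.Ico (replyTime X Y D W t₀ k ω : ℝ) (replyTime X Y D W t₀ (k + 1) ω), 1) ∂μ =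
      μ (sampleEvent X Y D W t₀ T k i) * cycleLength W FY FD i := by
    intro T k i
    have hφm : Measurable fun c : ℝ≥0 × ℝ≥0 × ℝ≥0 =>
        ((W i c.1 + (c.2.1 + c.2.2) : ℝ≥0) : ENNReal) :=
      measurable_coe_nnreal_ennreal.comp (((hW i).comp measurable_fst).add (by fun_prop))
    rw [cycleLength, ← setLIntegral_sampleEvent_delays hX hYD hW T k i hφm]
    refine setLIntegral_congr_fun (measurableSet_sampleEvent hXm hY hD hW T k i) fun ω hω => ?_
    simp only [replyTime_succ, hω.2]
    rw [lintegral_one, Measure.restrict_apply_univ, Real.volume_Ico, NNReal.coe_add,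
      add_sub_cancel_left, ENNReal.ofReal_coe_nnreal, add_assoc]
  have hHrew := fun T k i => setLIntegral_sampleEvent_reward (t₀ := t₀) (e₀ := e₀) hX hYD hW he T k i
  have hρ := lintegral_replyTime_zero_ne_top (W := W) (t₀ := t₀) hYD
  have hone : ∀ T : ℝ≥0, ∫⁻ _, (∫⁻ _ in Set.Ico (0 : ℝ) T, 1) ∂μ = (T : ENNReal) := by
    intro T
    simp
  have hAle : ∀ T : ℝ≥0, ∫⁻ ω, (∫⁻ t in Set.Ico (0 : ℝ) T,
      correct X (estimate X Y D W t₀ e₀ e) t ω) ∂μ ≤ T := by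
    intro T
    rw [← hone T]
    exact lintegral_mono fun ω => lintegral_mono fun t => hJ1 t ω
  have hAtop : ∀ T : ℝ≥0, ∫⁻ ω, (∫⁻ t in Set.Ico (0 : ℝ) T,
      correct X (estimate X Y D W t₀ e₀ e) t ω) ∂μ ≠ ⊤ := fun T =>
    ne_top_of_le_ne_top ENNReal.coe_ne_top (hAle T)
  have hK0 : ∀ i j, 0 ≤ embeddedKernel Q W FY FD i j := fun i j => hε.le.trans (hK i j)
  have hKtop : ∀ i j, cycleTransition Q W FY FD i j ≠ ⊤ := fun i j => by
    rw [cycleTransition_eq hQ hW]; exact ENNReal.ofReal_ne_top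
  have hKreal : ∀ i j, (cycleTransition Q W FY FD i j).toReal = embeddedKernel Q W FY FD i j :=
    fun i j => by rw [cycleTransition_eq hQ hW, ENNReal.toReal_ofReal (hK0 i j)]
  have hfinsum : ∀ (T : ℝ≥0) (H : S → ENNReal), (∀ i, H i ≠ ⊤) →
      ∑ i, visits X Y D W t₀ μ T i * H i ≠ ⊤ := fun T H hH =>
    ENNReal.sum_ne_top.2 fun i _ => ENNReal.mul_ne_top (htop T i) (hH i)
  -- passage from the extended nonnegative to the real inequalities
  have hupper : ∀ (T : ℝ≥0) (x : ENNReal) (H : S → ENNReal), (∀ i, H i ≠ ⊤) →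
      x ≤ ∫⁻ ω, (replyTime X Y D W t₀ 0 ω : ENNReal) ∂μ + ∑ i, visits X Y D W t₀ μ T i * H i →
      x.toReal ≤ (∫⁻ ω, (replyTime X Y D W t₀ 0 ω : ENNReal) ∂μ).toReal +
        ∑ i, (visits X Y D W t₀ μ T i).toReal * (H i).toReal := by
    intro T x H hH hx
    rw [← toReal_sum_mul (htop T) hH, ← ENNReal.toReal_add hρ (hfinsum T H hH)]
    exact ENNReal.toReal_mono (ENNReal.add_ne_top.2 ⟨hρ, hfinsum T H hH⟩) hx
  have hlower : ∀ (T b : ℝ≥0) (δ : ℝ) (x v : ENNReal) (H : S → ENNReal), 0 < δ → x ≠ ⊤ →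
      (∀ i, H i ≠ ⊤) → v ≤ ENNReal.ofReal δ →
      ∑ i, visits X Y D W t₀ μ T i * H i ≤ x + b + ∑ i, visits X Y D W t₀ μ T i * v →
      ∑ i, (visits X Y D W t₀ μ T i).toReal * (H i).toReal ≤
        x.toReal + b + δ * ∑ i, (visits X Y D W t₀ μ T i).toReal := by
    intro T b δ x v H hδ hx hH hv h
    have h1 : ∑ i, visits X Y D W t₀ μ T i * H i ≤
        x + b + ∑ i, visits X Y D W t₀ μ T i * ENNReal.ofReal δ := by
      refine h.trans ?_
      gcongr
    have h2 := hfinsum T (fun _ => ENNReal.ofReal δ) fun _ => ENNReal.ofReal_ne_top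
    have h3 := ENNReal.toReal_mono (by finiteness) h1
    rw [toReal_sum_mul (htop T) hH, ENNReal.toReal_add (by finiteness) h2,
      ENNReal.toReal_add hx ENNReal.coe_ne_top,
      toReal_sum_mul (htop T) fun _ => ENNReal.ofReal_ne_top, ENNReal.toReal_ofReal hδ.le,
      ENNReal.coe_toReal, ← Finset.sum_mul, mul_comm _ δ] at h3
    exact h3
  refine tendsto_reward_rate (K := embeddedKernel Q W FY FD) hε hK
    (embeddedKernel_sum hQ hW) hφ hφ0
    (fun i => ENNReal.toReal_nonneg) hlpos
    (a := fun T i => (visits X Y D W t₀ μ T.toNNReal i).toReal)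
    (fun T hT j => ?_) (fun T hT => Finset.sum_nonneg fun i _ => ENNReal.toReal_nonneg)
    (c := c.toReal) (ρ := (∫⁻ ω, (replyTime X Y D W t₀ 0 ω : ENNReal) ∂μ).toReal)
    (ENNReal.toReal_pos hc0 hctop) (fun T hT => ?_) (fun T hT => ?_) (fun T hT => ?_)
    (fun δ hδ => ?_)
  · obtain ⟨h1, h2⟩ := visits_le_sum_add_one (t₀ := t₀) hX hYD hW T.toNNReal j
    have hs := hfinsum T.toNNReal _ fun i => hKtop i j
    have h1' := ENNReal.toReal_mono (by finiteness) h1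
    have h2' := ENNReal.toReal_mono (ENNReal.add_ne_top.2 ⟨htop _ _, ENNReal.one_ne_top⟩) h2
    rw [ENNReal.toReal_add hs ENNReal.one_ne_top, toReal_sum_mul (htop _) fun i => hKtop i j,
      ENNReal.toReal_one] at h1'
    rw [ENNReal.toReal_add (htop _ _) ENNReal.one_ne_top,
      toReal_sum_mul (htop _) fun i => hKtop i j, ENNReal.toReal_one] at h2'
    simp only [hKreal] at h1' h2'
    rw [abs_le]
    constructor <;> linarith
  · have h := ENNReal.toReal_mono (by finiteness) (hc T.toNNReal)
    rwa [ENNReal.toReal_mul, ENNReal.toReal_sum fun i _ => htop _ i,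
      ENNReal.toReal_add ENNReal.coe_ne_top ENNReal.one_ne_top, ENNReal.coe_toReal,
      Real.coe_toNNReal T hT.le, ENNReal.toReal_one] at h
  · lift T to ℝ≥0 using hT.le
    rw [integral_correct hXm hest, Real.toNNReal_coe]
    exact hupper T _ _ hgtop
      (lintegral_reward_le hXm hY hD hW T (htop T) hJ hJ1 (hHrew T))
  · lift T to ℝ≥0 using hT.le
    rw [Real.toNNReal_coe]
    have h := lintegral_reward_le (J := fun _ _ => 1) hXm hY hD hW T (htop T) measurable_const
      (fun _ _ => le_rfl) (hHlen T)
    rw [hone] at h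
    exact hupper T _ _ hltop h
  · obtain ⟨b, hb⟩ := exists_overshoot_le hYD.integrable_forward hYD.integrable_backward C hδ
    refine ⟨b, fun T hT => ?_⟩
    lift T to ℝ≥0 using hT.le
    rw [integral_correct hXm hest, Real.toNNReal_coe]
    refine ⟨hlower T b δ _ _ _ hδ (hAtop T) hgtop hb
      (le_lintegral_reward_add hX hYD hW hC T b hJ hJ1 (hHrew T)), ?_⟩
    have h := le_lintegral_reward_add (J := fun _ _ => 1) hX hYD hW hC T b measurable_const
      (fun _ _ => le_rfl) (hHlen T)
    rw [hone] at h
    exact hlower T b δ _ _ _ hδ ENNReal.coe_ne_top hltop hb h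

/-- The inner integral has ordered end points and a nonnegative integrand, so it is the `toReal` of
the integral in `cycleReward`; at times t ≥ 0 the truncation `t.toNNReal` is invisible. -/
theorem integral_cycleLaw_reward (hQ : IsGenerator Q) (hW : ∀ i, Measurable (W i))
    {e : S → ℝ≥0 → S} (he : ∀ i, Measurable (e i)) (hfin : ∀ i, cycleReward Q W FY FD e i ≠ ⊤)
    (φ : PMF S) :
    ∫ c, (∫ t in (c.2.1 : ℝ)..((c.2.1 : ℝ) + W c.1 c.2.1 + (c.2.2.1 + c.2.2.2)),
        transitionMatrix Q t c.1 (e c.1 t.toNNReal)) ∂(cycleLaw φ FY FD) =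
      ∑ i, (φ i).toReal * (cycleReward Q W FY FD e i).toReal := by
  let R : S → ℝ≥0 × ℝ≥0 × ℝ≥0 → ENNReal := fun i c =>
    ∫⁻ t in Set.Ico (c.1 : ℝ) ((c.1 + (W i c.1 + (c.2.1 + c.2.2)) : ℝ≥0) : ℝ),
      ENNReal.ofReal (transitionMatrix Q (t.toNNReal : ℝ) i (e i t.toNNReal))
  have hPm : ∀ i, Measurable fun t : ℝ => transitionMatrix Q t i (e i t.toNNReal) := by
    intro i
    have h1 : Measurable fun q : S × ℝ => transitionMatrix Q q.2 i q.1 :=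
      measurable_from_prod_countable_right fun j => (continuous_transitionMatrix Q i j).measurable
    exact h1.comp (((he i).comp measurable_real_toNNReal).prodMk measurable_id)
  have hPm' : ∀ i, Measurable fun t : ℝ =>
      ENNReal.ofReal (transitionMatrix Q (t.toNNReal : ℝ) i (e i t.toNNReal)) := by
    intro i
    have h1 : Measurable fun q : S × ℝ => transitionMatrix Q (q.2.toNNReal : ℝ) i q.1 :=
      measurable_from_prod_countable_right fun j =>
        (continuous_transitionMatrix Q i j).measurable.comp
          (NNReal.continuous_coe.measurable.comp measurable_real_toNNReal)
    exact (h1.comp (((he i).comp measurable_real_toNNReal).prodMk measurable_id)).ennreal_ofReal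
  have hRm : ∀ i, Measurable (R i) := by
    intro i
    refine measurable_setLIntegral_Ico
      (J := fun t (_ : ℝ≥0 × ℝ≥0 × ℝ≥0) =>
        ENNReal.ofReal (transitionMatrix Q (t.toNNReal : ℝ) i (e i t.toNNReal)))
      ((hPm' i).comp measurable_fst) measurable_fst ?_
    exact measurable_fst.add (((hW i).comp measurable_fst).add (by fun_prop))
  have hinner : ∀ i (c : ℝ≥0 × ℝ≥0 × ℝ≥0),
      ∫ t in (c.1 : ℝ)..((c.1 : ℝ) + W i c.1 + (c.2.1 + c.2.2)),
        transitionMatrix Q t i (e i t.toNNReal) = (R i c).toReal := by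
    intro i c
    have hend : (c.1 : ℝ) + W i c.1 + (c.2.1 + c.2.2) =
        ((c.1 + (W i c.1 + (c.2.1 + c.2.2)) : ℝ≥0) : ℝ) := by push_cast; ring
    rw [hend, intervalIntegral_eq_toReal_setLIntegral (hPm i)
      (NNReal.coe_le_coe.2 le_self_add)
      fun t ht => transitionMatrix_nonneg Q hQ ((NNReal.coe_nonneg _).trans ht.1) _ _]
    congr 1
    refine setLIntegral_congr_fun measurableSet_Ico fun t ht => ?_
    simp only [Real.coe_toNNReal t ((NNReal.coe_nonneg _).trans ht.1)]
  rw [cycleLaw, integral_prod_pmf]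
  · refine Finset.sum_congr rfl fun i _ => ?_
    congr 1
    simp only [hinner]
    rw [integral_toReal (hRm i).aemeasurable (ae_lt_top (hRm i) (hfin i))]
    rfl
  · intro i
    simp only [hinner]
    exact (hRm i).ennreal_toReal
  · intro i
    simp only [hinner]
    exact integrable_toReal_of_lintegral_ne_top (hRm i).aemeasurable (hfin i)

omit [DecidableEq S] in
theorem integral_cycleLaw_length (hW : ∀ i, Measurable (W i)) {C : ℝ≥0} (hC : ∀ i d, W i d ≤ C)
    (hY : Integrable (fun y : ℝ≥0 => (y : ℝ)) FY) (hD : Integrable (fun d : ℝ≥0 => (d : ℝ)) FD)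
    (φ : PMF S) :
    (∫ c, (W c.1 c.2.1 : ℝ) ∂(cycleLaw φ FY FD)) +
        ∫ c, ((c.2.2.1 : ℝ) + c.2.2.2) ∂(cycleLaw φ FY FD) =
      ∑ i, (φ i).toReal * (cycleLength W FY FD i).toReal := by
  have h1 : ∀ i, Integrable (fun c => (W i c.1 : ℝ)) (FD.prod (FY.prod FD)) := fun i =>
    integrable_cycle_fst (integrable_wait hW hC i)
  have h2 : Integrable (fun c => (c.2.1 : ℝ)) (FD.prod (FY.prod FD)) := integrable_cycle_snd hY
  have h3 : Integrable (fun c => (c.2.2 : ℝ)) (FD.prod (FY.prod FD)) := integrable_cycle_thd hD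
  have h23 : ∀ i : S, Integrable (fun c : ℝ≥0 × ℝ≥0 × ℝ≥0 =>
      (fun q : S × ℝ≥0 × ℝ≥0 × ℝ≥0 => (q.2.2.1 : ℝ) + q.2.2.2) (i, c)) (FD.prod (FY.prod FD)) :=
    fun i => h2.add h3
  rw [cycleLaw, integral_prod_pmf φ _ (fun i => NNReal.continuous_coe.measurable.comp
      ((hW i).comp measurable_fst)) h1,
    integral_prod_pmf φ _ (fun i => by fun_prop) h23, ← Finset.sum_add_distrib]
  refine Finset.sum_congr rfl fun i _ => ?_
  have hnn : 0 ≤ (∫ d, (W i d : ℝ) ∂FD) + ((∫ y, (y : ℝ) ∂FY) + ∫ d, (d : ℝ) ∂FD) := by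
    positivity
  simp only
  rw [cycleLength_eq hW hC hY hD, ENNReal.toReal_ofReal hnn, integral_add h2 h3,
    integral_cycle_fst (fun d => (W i d : ℝ)), integral_cycle_snd (fun y => (y : ℝ)),
    integral_cycle_thd (fun d => (d : ℝ))]
  ring

omit [DecidableEq S] [MeasurableSpace S] [DiscreteMeasurableSpace S] in
theorem exists_pmf_of_isStationary {K : Matrix S S ℝ} {φ : S → ℝ} (hφ : IsStationary K φ)
    (hφ0 : ∀ i, 0 ≤ φ i) : ∃ p : PMF S, (fun i => (p i).toReal) = φ := by
  refine ⟨PMF.ofFintype (fun i => ENNReal.ofReal (φ i)) ?_, ?_⟩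
  · rw [← ENNReal.ofReal_sum_of_nonneg fun i _ => hφ0 i, hφ.2, ENNReal.ofReal_one]
  · ext i
    simp [ENNReal.toReal_ofReal (hφ0 i)]

end Freshness

end QuerySampling
-- The freshness formula
open QuerySampling in
theorem theorem1
    {S : Type*} [Fintype S] [DecidableEq S] [Nonempty S]
    [MeasurableSpace S] [DiscreteMeasurableSpace S]
    {Ω : Type*} [MeasurableSpace Ω] (μ : Measure Ω) [IsProbabilityMeasure μ]
    -- the source
    (Q : Matrix S S ℝ) (hQ : IsGenerator Q) (hirr : QuerySampling.IsIrreducible Q)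
    (X : ℝ≥0 → Ω → S) (hX : IsCTMC Q X μ)
    -- the delays
    (FY FD : Measure ℝ≥0) [IsProbabilityMeasure FY] [IsProbabilityMeasure FD]
    (Y D : ℕ → Ω → ℝ≥0) (hYD : IsDelaySequence X Y D FY FD μ)
    -- the bounded stationary waiting policy
    (W : S → ℝ≥0 → ℝ≥0) (hW : ∀ i, Measurable (W i)) (hWb : ∃ C : ℝ≥0, ∀ i d, W i d ≤ C)
    -- the time between consecutive replies does not vanish identically from any state
    (hpos : ∀ i, 0 < (∫ d, (W i d : ℝ) ∂FD) + ((∫ y, (y : ℝ) ∂FY) + ∫ d, (d : ℝ) ∂FD))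
    -- the time of the first query, and the estimator
    (t₀ : ℝ≥0) (e₀ : ℝ≥0 → S) (he₀ : Measurable e₀)
    (e : S → ℝ≥0 → S) (he : ∀ i, Measurable (e i)) :
    ∃ φ : PMF S,
      IsStationary (embeddedKernel Q W FY FD) (fun i => (φ i).toReal) ∧
      (∀ ψ : S → ℝ, IsStationary (embeddedKernel Q W FY FD) ψ → ψ = fun i => (φ i).toReal) ∧
      meanBinaryFreshness X (estimate X Y D W t₀ e₀ e) μ =
        (∫ c, (∫ t in (c.2.1 : ℝ)..((c.2.1 : ℝ) + W c.1 c.2.1 + (c.2.2.1 + c.2.2.2)),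
            transitionMatrix Q t c.1 (e c.1 t.toNNReal)) ∂(cycleLaw φ FY FD)) /
          ((∫ c, (W c.1 c.2.1 : ℝ) ∂(cycleLaw φ FY FD)) +
            ∫ c, ((c.2.2.1 : ℝ) + c.2.2.2) ∂(cycleLaw φ FY FD)) := by
  obtain ⟨C, hC⟩ := hWb
  -- The smallest of the finitely many positive kernel entries serves as the uniform lower bound ε.
  obtain ⟨p, hp⟩ := Finite.exists_min fun p : S × S => embeddedKernel Q W FY FD p.1 p.2
  have hε := embeddedKernel_pos hQ hirr hW (hpos p.1) p.2
  have hK : ∀ i j, embeddedKernel Q W FY FD p.1 p.2 ≤ embeddedKernel Q W FY FD i j :=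
    fun i j => hp (i, j)
  have hsum := embeddedKernel_sum (FY := FY) (FD := FD) hQ hW
  obtain ⟨ψ, hψ, hψ0⟩ := exists_isStationary hε hK hsum
  obtain ⟨φ, hφ⟩ := exists_pmf_of_isStationary hψ hψ0
  rw [← hφ] at hψ
  have hlen := cycleLength_eq hW hC hYD.integrable_forward hYD.integrable_backward
  have hfin : ∀ i, cycleReward Q W FY FD e i ≠ ⊤ := fun i =>
    ne_top_of_le_ne_top (by rw [hlen]; exact ENNReal.ofReal_ne_top)
      (cycleReward_le_cycleLength hQ e i)
  refine ⟨φ, hψ, fun ψ' hψ' => IsStationary.unique hε hK hsum hψ hψ', ?_⟩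
  rw [integral_cycleLaw_reward hQ hW he hfin,
    integral_cycleLaw_length hW hC hYD.integrable_forward hYD.integrable_backward]
  exact (tendsto_meanFreshness hQ hX hYD hW hC hpos he₀ he hε hK hψ
    fun i => ENNReal.toReal_nonneg).limsup_eq
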